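/- **Setting.** Let $M$ be a stationary episodic Markov decision process with finite state space of size $S\ge 1$, finite action space of size $A\ge 1$, horizon $H\ge 1$, transition probabilities $p(s'\mid s,a)$ and mean rewards $r(s,a)\in[0,1]$. For a policy $\pi$ (a map from states and timesteps to actions) let $V_t^\pi(s)$ be the expected total reward in timesteps $t,\dots,H$ when $\pi$ is followed from $s$, with $V^\pi_{H+1}=0$, and let $V_t^*=\sup_\pi V_t^\pi$. A learning algorithm (EULER, or any other algorithm whose actions and initial states may depend arbitrarily on the past) interacts with $M$ for $K\ge1$ episodes; put $T=KH$. Let $n_k(s,a)$ be the number of visits to $(s,a)$ before episode $k$, and $\hat p_k(s,a)$ the empirical distribution of the next states observed in these visits. Write $\operatorname{Var}_pV$ for the variance of $V$ under $p$ and $\|X\|_{2,p}=\big(\sum_{s'}p(s')X(s')^2\big)^{1/2}$. **Admissibility.** Let $\delta'\in(0,1)$. An interval $\phi$, which is a function of $p$, $V$ and the visit count $n$, is *admissible* with leading term $g$, lower order term $j$ and constants $J,B_v,B_p$ if the following hold. 1. With probability at least $1-\delta'$, jointly for all timesteps $t\in[H]$, episodes $k\in[K]$, and all $s,a$ with $n=n_k(s,a)\ge1$,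 $$\big|(\hat p_k(s,a)-p(s,a))^\top V^*_{t+1}\big|\le\phi(p(s,a),V^*_{t+1}).$$ 2. For all probability vectors $p$, all $V,V_1,V_2\in\mathbb R^S$, all $n\ge 1$ and all $\alpha\in\mathbb R$: $\phi(p,V)=\frac{g(p,V)}{\sqrt n}+\frac{j(p,V)}{n}$ with $j(p,V)\le J$; $|g(p,V_1)-g(p,V_2)|\le B_v\|V_1-V_2\|_{2,p}$; and $g(p,\alpha\mathbf 1)=0$. 3. With probability at least $1-\delta'$, jointly for all $t\in[H]$, $k\in[K]$, and all $s,a$ with $n=n_k(s,a)\ge1$, $$\big|g(\hat p_k(s,a),V^*_{t+1})-g(p(s,a),V^*_{t+1})\big|\le \frac{B_p}{\sqrt n}.$$ **Proposition.** Let $\ell=\ln\frac{2SAT}{\delta'}$ and $L=\sqrt{2\ell}$. The Bernstein confidence interval $$\phi(p,V)=\sqrt{\frac{2\operatorname{Var}_pV\cdot\ln\frac{2SAT}{\delta'}}{n}}+\frac Jn,\qquad J=3H\ell=\tilde O(H),$$ is admissible, with $g(p,V)=L\sqrt{\operatorname{Var}_pV}$, $j=J$, $B_v=L=\tilde O(1)$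 and $B_p=4H\ell=\tilde O(H)$. Moreover, for each fixed timestep $t\in[H]$, with probability at least $1-\delta'$, jointly for all episodes $k\in[K]$ and all $s,a$ with $n=n_k(s,a)\ge1$, condition 1 already holds with the smaller lower order constant $H\ell/3$: $$\big|(\hat p_k(s,a)-p(s,a))^\top V^*_{t+1}\big|\le\sqrt{\frac{2\operatorname{Var}_{p(s,a)}V^*_{t+1}\cdot\ell}{n}}+\frac{H\ell}{3n}.$$ -/

import Mathlib

open MeasureTheory

namespace Euler

/-- A finite-horizon, stationary, tabular Markov decision process with transition probabilities
`p s a s'`, mean rewards `r s a ∈ [0,1]` and horizon `H`. -/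
structure MDP (S A : Type*) [Fintype S] where
  H : ℕ
  H_pos : 1 ≤ H
  p : S → A → S → ℝ
  p_mem : ∀ s a, p s a ∈ stdSimplex ℝ S
  r : S → A → ℝ
  r_mem : ∀ s a, r s a ∈ Set.Icc (0 : ℝ) 1

section Values

variable {S A : Type*} [Fintype S]

/-- Expected total mean reward of the policy `π` (a map from states and timesteps to actions)
when it acts for `m` further steps, starting from state `s` at timestep `t`. -/
def MDP.returnFrom (M : MDP S A) (π : S → ℕ → A) : ℕ → ℕ → S → ℝ
  | 0, _, _ => 0
  | m + 1, t, s =>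
      M.r s (π s t) + ∑ s', M.p s (π s t) s' * MDP.returnFrom M π m (t + 1) s'

/-- The value function `V_t^π` of a policy; timesteps are `1, …, H` and `V_{H+1}^π = 0`. -/
def MDP.policyValue (M : MDP S A) (π : S → ℕ → A) (t : ℕ) (s : S) : ℝ :=
  M.returnFrom π (M.H + 1 - t) t s

/-- The optimal value function `V_t^*`. -/
noncomputable def MDP.optValue (M : MDP S A) (t : ℕ) (s : S) : ℝ :=
  ⨆ π : S → ℕ → A, M.policyValue π t s

/-- The expectation `p^⊤ V`. -/
def expect (p V : S → ℝ) : ℝ := ∑ s, p s * V s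

/-- The variance `Var_p V`. -/
def variance (p V : S → ℝ) : ℝ := ∑ s, p s * (V s - expect p V) ^ 2

/-- The norm `‖X‖_{2,p}`. -/
noncomputable def norm2 (p X : S → ℝ) : ℝ := √(∑ s, p s * X s ^ 2)

end Values

/-- A run of a learning algorithm on `M` for `K` episodes (numbered `1, …, K`) of `H` steps.
`state k t` and `action k t` are the state and the action in timestep `t` of episode `k`;
`state k (H + 1)` is the state reached at the end of episode `k`.
The sigma-algebra `ℱ (k * H + t)` is the information available once the action in timestep `t` of
episode `k` has been chosen. It may contain more than the visited states and actions (sampled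
rewards, internal randomness of the algorithm), so initial states and actions may depend on the
past in any way. The only law that is imposed is that the next state is drawn from `p(s,a)`. -/
structure LearningRun {S A : Type*} [Fintype S] (M : MDP S A) (K : ℕ)
    {Ω : Type*} [mΩ : MeasurableSpace Ω] (μ : Measure Ω) where
  ℱ : Filtration ℕ mΩ
  state : ℕ → ℕ → Ω → S
  action : ℕ → ℕ → Ω → A
  measurable_state : ∀ k ∈ Finset.Icc 1 K, ∀ t ∈ Finset.Icc 1 M.H, ∀ s,
    MeasurableSet[ℱ (k * M.H + t)] {ω | state k t ω = s}
  measurable_action : ∀ k ∈ Finset.Icc 1 K, ∀ t ∈ Finset.Icc 1 M.H, ∀ a,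
    MeasurableSet[ℱ (k * M.H + t)] {ω | action k t ω = a}
  measurable_next : ∀ k ∈ Finset.Icc 1 K, ∀ t ∈ Finset.Icc 1 M.H, ∀ s,
    MeasurableSet[ℱ (k * M.H + t + 1)] {ω | state k (t + 1) ω = s}
  transition : ∀ k ∈ Finset.Icc 1 K, ∀ t ∈ Finset.Icc 1 M.H, ∀ s',
    μ[Set.indicator {ω | state k (t + 1) ω = s'} (fun _ => (1 : ℝ)) | ℱ (k * M.H + t)]
      =ᵐ[μ] fun ω => M.p (state k t ω) (action k t ω) s'

section Runs

variable {S A : Type*} [Fintype S] [DecidableEq S] [DecidableEq A] {M : MDP S A} {K : ℕ}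
  {Ω : Type*} [MeasurableSpace Ω] {μ : Measure Ω}

/-- `n_k(s,a)`: the number of visits to `(s,a)` before episode `k`. -/
def LearningRun.visits (R : LearningRun M K μ) (k : ℕ) (s : S) (a : A) (ω : Ω) : ℕ :=
  ∑ j ∈ Finset.Ico 1 k, ∑ t ∈ Finset.Icc 1 M.H,
    if R.state j t ω = s ∧ R.action j t ω = a then 1 else 0

/-- The number of observed transitions from `(s,a)` to `s'` before episode `k`. -/
def LearningRun.transitions (R : LearningRun M K μ) (k : ℕ) (s : S) (a : A) (s' : S) (ω : Ω) : ℕ :=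
  ∑ j ∈ Finset.Ico 1 k, ∑ t ∈ Finset.Icc 1 M.H,
    if R.state j t ω = s ∧ R.action j t ω = a ∧ R.state j (t + 1) ω = s' then 1 else 0

/-- The maximum likelihood estimate `p̂_k(s,a)`; meaningful only if `n_k(s,a) ≥ 1`. -/
noncomputable def LearningRun.pHat (R : LearningRun M K μ) (k : ℕ) (s : S) (a : A) (ω : Ω) :
    S → ℝ :=
  fun s' => (R.transitions k s a s' ω : ℝ) / (R.visits k s a ω : ℝ)

/-- The first admissibility condition, for an interval `φ n p V` that depends on the visit
count `n`, with leading term `g`, lower order term `j ≤ J` and Lipschitz constant `Bv`. -/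
structure ConfidenceIntervals (R : LearningRun M K μ) (δ' : ℝ)
    (φ : ℕ → (S → ℝ) → (S → ℝ) → ℝ) (g j : (S → ℝ) → (S → ℝ) → ℝ) (J Bv : ℝ) : Prop where
  holds : 1 - δ' ≤ μ.real {ω | ∀ t ∈ Finset.Icc 1 M.H, ∀ k ∈ Finset.Icc 1 K, ∀ s a,
    1 ≤ R.visits k s a ω →
      |expect (fun s' => R.pHat k s a ω s' - M.p s a s') (M.optValue (t + 1))|
        ≤ φ (R.visits k s a ω) (M.p s a) (M.optValue (t + 1))}
  form : ∀ n : ℕ, 1 ≤ n → ∀ p ∈ stdSimplex ℝ S, ∀ V : S → ℝ,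
    φ n p V = g p V / √(n : ℝ) + j p V / (n : ℝ)
  lower_order : ∀ p ∈ stdSimplex ℝ S, ∀ V : S → ℝ, j p V ≤ J
  lipschitz : ∀ p ∈ stdSimplex ℝ S, ∀ V₁ V₂ : S → ℝ,
    |g p V₁ - g p V₂| ≤ Bv * norm2 p (fun s => V₁ s - V₂ s)
  uniform_value : ∀ p ∈ stdSimplex ℝ S, ∀ α : ℝ, g p (fun _ => α) = 0

/-- The second admissibility condition: finite time rate of convergence of `g(p̂, V*)`. -/
def FiniteTimeBonusBound (R : LearningRun M K μ) (δ' : ℝ)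
    (g : (S → ℝ) → (S → ℝ) → ℝ) (Bp : ℝ) : Prop :=
  1 - δ' ≤ μ.real {ω | ∀ t ∈ Finset.Icc 1 M.H, ∀ k ∈ Finset.Icc 1 K, ∀ s a,
    1 ≤ R.visits k s a ω →
      |g (R.pHat k s a ω) (M.optValue (t + 1)) - g (M.p s a) (M.optValue (t + 1))|
        ≤ Bp / √(R.visits k s a ω : ℝ)}

/-- Admissibility of the confidence interval `φ`, with constants `J`, `Bv`, `Bp`. -/
def IsAdmissible (R : LearningRun M K μ) (δ' : ℝ)
    (φ : ℕ → (S → ℝ) → (S → ℝ) → ℝ) (g j : (S → ℝ) → (S → ℝ) → ℝ) (J Bv Bp : ℝ) : Prop :=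
  ConfidenceIntervals R δ' φ g j J Bv ∧ FiniteTimeBonusBound R δ' g Bp

end Runs

/-- `ln (2 S A T / δ')`, where `T = K H` is the total number of timesteps. -/
noncomputable def logTerm {S A : Type*} [Fintype S] [Fintype A] (M : MDP S A) (K : ℕ) (δ' : ℝ) :
    ℝ :=
  Real.log (2 * (Fintype.card S : ℝ) * (Fintype.card A : ℝ) * ((K : ℝ) * (M.H : ℝ)) / δ')

/-- The Bernstein interval `√(2 Var_p V · ℓ / n) + J / n`. -/
noncomputable def bernsteinInterval {S : Type*} [Fintype S] (ℓ J : ℝ) (n : ℕ) (p V : S → ℝ) : ℝ :=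
  √(2 * variance p V * ℓ / (n : ℝ)) + J / (n : ℝ)

end Euler

/-!
At each visit to a fixed state-action pair, the next state has law `p(s,a)` given the past.
Bernstein's exponential moment bound (`sum_mul_exp_le_one`) turns the deviation of a
function `f` of the next state, summed over the visits, into a nonnegative supermartingale
`exp (λ (∑ (f - p^⊤ f) - n v θ / 2))`, and Ville's inequality controls it at all times at once:
outside an event of probability `e^{-x}`, the sum of deviations stays below the line
`n v θ / 2 + x / θ + b x / 3` for every visit count `n` (`SampledFrom.measure_line_le`). These lines
are the tangents of the curve `√(2 n v x) + b x / 3`. Choosing the tangent at each `n ≤ T` and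
taking a union bound over `n`, both signs and all pairs gives the claim for a fixed timestep, whose
constants are exactly those of `ln (2SAT/δ')`.

The bound on the empirical standard deviation also follows in this way, from Bernstein's inequality
for `V` and for `(V - p^⊤ V)^2`: the target constant leaves room for the level `2 ℓ`, and the
additional factor `e^{-ℓ} ≤ 1 / (2T)` pays for the union over timesteps
(`abs_sub_le_of_moment_bounds`).

For the first condition jointly over timesteps, such a union bound would replace `ℓ` by
`ℓ + ln H` in the leading term, which the term `3 H ℓ / n` cannot absorb. Instead,
`SampledFrom.measure_family_le` uses that the process is stationary: the optimal value with `r`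
remaining steps does not depend on the timestep, and its increments in `r` lie in `[0, 1]`
(`MDP.valueToGo_increments`). So it suffices to treat every `h`-th value with the leading term,
with `h` of order `H √(ℓ / T)`; and for each of them the room of order `H ℓ` above the curve
`√(2 n v ℓ)` means that about `√(T / ℓ)` tangent lines serve all visit counts `n`. The two
grids together consist of fewer than `T` events of probability `e^{-ℓ}`.
-/

namespace Euler

/-! ### Expectation, variance and the norm on a finite state space -/

section Finite

variable {S : Type*} [Fintype S] {p : S → ℝ}

lemma expect_sub (p f g : S → ℝ) :
    expect p (fun s => f s - g s) = expect p f - expect p g := by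
  simp [expect, mul_sub, Finset.sum_sub_distrib]

lemma expect_const (hp : p ∈ stdSimplex ℝ S) (c : ℝ) : expect p (fun _ => c) = c := by
  simp [expect, ← Finset.sum_mul, hp.2]

lemma expect_le (hp : p ∈ stdSimplex ℝ S) {f : S → ℝ} {b : ℝ} (hf : ∀ s, f s ≤ b) :
    expect p f ≤ b := by
  rw [← expect_const hp b]
  exact Finset.sum_le_sum fun s _ => mul_le_mul_of_nonneg_left (hf s) (hp.1 s)

lemma le_expect (hp : p ∈ stdSimplex ℝ S) {f : S → ℝ} {b : ℝ} (hf : ∀ s, b ≤ f s) :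
    b ≤ expect p f := by
  rw [← expect_const hp b]
  exact Finset.sum_le_sum fun s _ => mul_le_mul_of_nonneg_left (hf s) (hp.1 s)

lemma variance_nonneg (hp : p ∈ stdSimplex ℝ S) (f : S → ℝ) : 0 ≤ variance p f :=
  Finset.sum_nonneg fun s _ => mul_nonneg (hp.1 s) (sq_nonneg _)

/-- The second moment about `c` splits into the variance and the squared bias. -/
lemma sum_mul_sub_sq (hp : p ∈ stdSimplex ℝ S) (f : S → ℝ) (c : ℝ) :
    ∑ s, p s * (f s - c) ^ 2 = variance p f + (expect p f - c) ^ 2 := by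
  have h : ∀ s, p s * (f s - c) ^ 2 = p s * (f s - expect p f) ^ 2
      + 2 * (expect p f - c) * (p s * f s)
      + p s * ((expect p f - c) ^ 2 - 2 * (expect p f - c) * expect p f) := fun s => by ring
  have he : ∑ s, p s * f s = expect p f := rfl
  simp_rw [h, Finset.sum_add_distrib, ← Finset.mul_sum, ← Finset.sum_mul, he, hp.2]
  rw [variance]; ring

lemma variance_le_sum_sub_sq (hp : p ∈ stdSimplex ℝ S) (f : S → ℝ) (c : ℝ) :
    variance p f ≤ ∑ s, p s * (f s - c) ^ 2 := by
  rw [sum_mul_sub_sq hp]; nlinarith [sq_nonneg (expect p f - c)]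

/-- Popoviciu's inequality. -/
lemma variance_le_of_mem_Icc (hp : p ∈ stdSimplex ℝ S) {f : S → ℝ} {a b : ℝ}
    (hf : ∀ s, f s ∈ Set.Icc a b) : variance p f ≤ ((b - a) / 2) ^ 2 := by
  refine (variance_le_sum_sub_sq hp f ((a + b) / 2)).trans ?_
  refine expect_le hp (f := fun s => (f s - (a + b) / 2) ^ 2) fun s => ?_
  have := hf s
  exact sq_le_sq' (by linarith [this.1]) (by linarith [this.2])

lemma variance_const_sub (hp : p ∈ stdSimplex ℝ S) (f : S → ℝ) (c : ℝ) :
    variance p (fun s => c - f s) = variance p f := by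
  simp only [variance, expect_sub, expect_const hp]
  exact Finset.sum_congr rfl fun s _ => by ring

lemma variance_neg (p f : S → ℝ) : variance p (fun s => -f s) = variance p f := by
  have : expect p (fun s => -f s) = -expect p f := by simp [expect]
  simp only [variance, this]
  exact Finset.sum_congr rfl fun s _ => by ring

/-- A function within `b` of its mean has a square deviation whose variance is at most `b ^ 2`
times its own. -/
lemma variance_sq_sub_expect_le (hp : p ∈ stdSimplex ℝ S) {f : S → ℝ} {b : ℝ}
    (hf : ∀ s, |f s - expect p f| ≤ b) :
    variance p (fun s => (f s - expect p f) ^ 2) ≤ b ^ 2 * variance p f := by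
  refine (variance_le_sum_sub_sq hp _ 0).trans ?_
  rw [variance, Finset.mul_sum]
  refine Finset.sum_le_sum fun s _ => ?_
  have h2 : (f s - expect p f) ^ 2 ≤ b ^ 2 := sq_le_sq.2 ((hf s).trans (le_abs_self b))
  have := mul_le_mul_of_nonneg_right h2 (mul_nonneg (hp.1 s) (sq_nonneg (f s - expect p f)))
  calc _ = (f s - expect p f) ^ 2 * (p s * (f s - expect p f) ^ 2) := by ring
    _ ≤ _ := this

lemma norm2_eq_norm (hp : p ∈ stdSimplex ℝ S) (X : S → ℝ) :
    norm2 p X = ‖(WithLp.toLp 2 fun s => √(p s) * X s : EuclideanSpace ℝ S)‖ := by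
  rw [EuclideanSpace.norm_eq, norm2]
  congr 1
  refine Finset.sum_congr rfl fun s _ => ?_
  rw [Real.norm_eq_abs, sq_abs, mul_pow, Real.sq_sqrt (hp.1 s)]

lemma abs_norm2_sub_norm2_le (hp : p ∈ stdSimplex ℝ S) (X Y : S → ℝ) :
    |norm2 p X - norm2 p Y| ≤ norm2 p (fun s => X s - Y s) := by
  simp only [norm2_eq_norm hp]
  refine (abs_norm_sub_norm_le _ _).trans (le_of_eq ?_)
  congr 1
  ext s
  simp [mul_sub]

lemma abs_sqrt_variance_sub_le (hp : p ∈ stdSimplex ℝ S) (f g : S → ℝ) :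
    |√(variance p f) - √(variance p g)| ≤ √(variance p fun s => f s - g s) := by
  refine (abs_norm2_sub_norm2_le hp (fun s => f s - expect p f)
    (fun s => g s - expect p g)).trans (le_of_eq ?_)
  rw [norm2, variance, expect_sub]
  congr 1
  exact Finset.sum_congr rfl fun s _ => by ring

lemma sqrt_variance_le_norm2 (hp : p ∈ stdSimplex ℝ S) (f : S → ℝ) :
    √(variance p f) ≤ norm2 p f := by
  refine Real.sqrt_le_sqrt ((variance_le_sum_sub_sq hp f 0).trans (le_of_eq ?_))
  simp

end Finite

/-! ### The exponential moment in Bernstein's inequality -/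

/-- The function `6 + 4 u + u ^ 2 - (6 - 2 u) e ^ u` is convex with a double zero at `0`. -/
lemma exp_mul_six_sub_le (u : ℝ) : Real.exp u * (6 - 2 * u) ≤ 6 + 4 * u + u ^ 2 := by
  set F : ℝ → ℝ := fun u => 6 + 4 * u + u ^ 2 - Real.exp u * (6 - 2 * u) with hF
  set F' : ℝ → ℝ := fun u => 4 + 2 * u - Real.exp u * (4 - 2 * u) with hF'
  have d1 : ∀ x, HasDerivAt F (F' x) x := fun x => by
    have h := ((((hasDerivAt_id x).const_mul 4).const_add 6).add ((hasDerivAt_id x).pow 2)).sub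
      ((Real.hasDerivAt_exp x).mul (((hasDerivAt_id x).const_mul 2).const_sub 6))
    refine (h.congr_deriv ?_)
    simp [hF']; ring
  have d2 : ∀ x, HasDerivAt F' (2 - 2 * (Real.exp x * (1 - x))) x := fun x => by
    have h := (((hasDerivAt_id x).const_mul 2).const_add 4).sub
      ((Real.hasDerivAt_exp x).mul (((hasDerivAt_id x).const_mul 2).const_sub 4))
    refine (h.congr_deriv ?_)
    simp; ring
  have hmono : Monotone F' := monotone_of_hasDerivAt_nonneg d2 fun x => by
    have h1 : 1 - x ≤ Real.exp (-x) := by linarith [Real.add_one_le_exp (-x)]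
    have h2 : Real.exp x * (1 - x) ≤ 1 := by
      calc _ ≤ Real.exp x * Real.exp (-x) := by gcongr
        _ = 1 := by rw [← Real.exp_add]; simp
    simp only [Pi.zero_apply]; linarith
  have h0 : F' 0 = 0 := by simp [hF']
  have hF0 : F 0 = 0 := by simp [hF]
  have hc : Continuous F := by fun_prop
  suffices 0 ≤ F u by simp only [hF] at this; linarith
  rw [← hF0]
  rcases le_total 0 u with hu | hu
  · refine monotoneOn_of_deriv_nonneg (convex_Ici 0) hc.continuousOn
      (fun x _ => (d1 x).differentiableAt.differentiableWithinAt) (fun x hx => ?_)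
      Set.self_mem_Ici hu hu
    rw [interior_Ici] at hx
    rw [(d1 x).deriv, ← h0]; exact hmono hx.le
  · refine antitoneOn_of_deriv_nonpos (convex_Iic 0) hc.continuousOn
      (fun x _ => (d1 x).differentiableAt.differentiableWithinAt) (fun x hx => ?_)
      hu Set.self_mem_Iic hu
    rw [interior_Iic] at hx
    rw [(d1 x).deriv, ← h0]; exact hmono hx.le

lemma exp_le_one_add_add_sq {u c : ℝ} (hu : u ≤ c) (hc : c < 3) :
    Real.exp u ≤ 1 + u + u ^ 2 / (2 * (1 - c / 3)) := by
  have h1 : Real.exp u ≤ 1 + u + u ^ 2 / (2 * (1 - u / 3)) := by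
    have h3 : 0 < 1 - u / 3 := by linarith
    have : 1 + u + u ^ 2 / (2 * (1 - u / 3)) = (6 + 4 * u + u ^ 2) / (6 - 2 * u) := by
      rw [eq_div_iff (by linarith), show 6 - 2 * u = 2 * (1 - u / 3) * 3 by ring, add_mul,
        ← mul_assoc (u ^ 2 / _), div_mul_cancel₀ _ (by linarith)]
      ring
    rw [this, le_div_iff₀ (by linarith)]
    exact exp_mul_six_sub_le u
  refine h1.trans ?_
  have : 0 < 1 - c / 3 := by linarith
  gcongr

/-- Bernstein's exponential moment bound. The exponent is `θ / (1 + b θ / 3)`, which makes the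
bound linear in `θ`. -/
lemma sum_mul_exp_le_one {S : Type*} [Fintype S] {p : S → ℝ} (hp : p ∈ stdSimplex ℝ S)
    {f : S → ℝ} {b v θ : ℝ} (hf : ∀ s, f s - expect p f ≤ b) (hv : variance p f ≤ v)
    (hb : 0 ≤ b) (hθ : 0 < θ) :
    ∑ s, p s * Real.exp (θ / (1 + b * θ / 3) * (f s - expect p f - v * θ / 2)) ≤ 1 := by
  set r : ℝ := θ / (1 + b * θ / 3) with hr
  have hd : 0 < 1 + b * θ / 3 := by positivity
  have hr0 : 0 < r := by positivity
  have hbr : b * r < 3 := by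
    rw [hr, mul_div_assoc', div_lt_iff₀ hd]; linarith
  have hrr : r ^ 2 / (2 * (1 - b * r / 3)) = r * θ / 2 := by
    have : 1 - b * r / 3 = 1 / (1 + b * θ / 3) := by rw [hr]; field_simp; ring
    rw [this, hr]; field_simp
  have key : ∑ s, p s * Real.exp (r * (f s - expect p f)) ≤ Real.exp (r * (v * θ / 2)) := by
    calc ∑ s, p s * Real.exp (r * (f s - expect p f))
        ≤ ∑ s, p s * (1 + r * (f s - expect p f)
            + (r * (f s - expect p f)) ^ 2 / (2 * (1 - b * r / 3))) := by
          refine Finset.sum_le_sum fun s _ => mul_le_mul_of_nonneg_left ?_ (hp.1 s)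
          refine exp_le_one_add_add_sq ?_ hbr
          rw [mul_comm b r]; exact mul_le_mul_of_nonneg_left (hf s) hr0.le
      _ = ∑ s, p s + r * (∑ s, p s * f s - (∑ s, p s) * expect p f)
            + r ^ 2 / (2 * (1 - b * r / 3)) * variance p f := by
          rw [variance, Finset.mul_sum, Finset.sum_mul, ← Finset.sum_sub_distrib, Finset.mul_sum,
            ← Finset.sum_add_distrib, ← Finset.sum_add_distrib]
          exact Finset.sum_congr rfl fun s _ => by ring
      _ = 1 + r * θ / 2 * variance p f := by
          rw [hp.2, hrr, ← expect]; ring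
      _ ≤ 1 + r * (v * θ / 2) := by
          have := mul_le_mul_of_nonneg_left hv (show 0 ≤ r * θ / 2 by positivity)
          linarith
      _ ≤ _ := by linarith [Real.add_one_le_exp (r * (v * θ / 2))]
  simp_rw [fun s => mul_sub r (f s - expect p f) (v * θ / 2), Real.exp_sub, ← mul_div_assoc,
    ← Finset.sum_div]
  rw [div_le_one (Real.exp_pos _)]
  simpa only [mul_div_assoc] using key

/-! ### Exponential supermartingales for the visits to one state-action pair -/

section Sampling

variable {S Ω : Type*} {U A : ℕ → Set Ω} {y : ℕ → Ω → S} {p : S → ℝ}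

/-- The number of visits before time `m`. -/
noncomputable def visitCount (U : ℕ → Set Ω) (m : ℕ) (ω : Ω) : ℕ :=
  ∑ i ∈ Finset.range m, (U i).indicator (fun _ => 1) ω

/-- The product of the factors `g (y i)` over the times `i < m` with `ω ∈ A i`. -/
noncomputable def weightProd (A : ℕ → Set Ω) (y : ℕ → Ω → S) (g : S → ℝ) (m : ℕ) (ω : Ω) : ℝ :=
  ∏ i ∈ Finset.range m, (1 + (A i).indicator (fun ω => g (y i ω) - 1) ω)

lemma visitCount_le (U : ℕ → Set Ω) (m : ℕ) (ω : Ω) : visitCount U m ω ≤ m := by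
  calc visitCount U m ω ≤ ∑ _i ∈ Finset.range m, 1 :=
        Finset.sum_le_sum fun i _ => Set.indicator_le_self' (fun _ _ => zero_le_one) ω
    _ = m := by simp

lemma weight_nonneg {g : S → ℝ} (hg : ∀ s, 0 ≤ g s) (i : ℕ) (ω : Ω) :
    0 ≤ 1 + (A i).indicator (fun ω => g (y i ω) - 1) ω := by
  by_cases h : ω ∈ A i <;> simp [h, hg]

lemma weightProd_nonneg {g : S → ℝ} (hg : ∀ s, 0 ≤ g s) (m : ℕ) (ω : Ω) :
    0 ≤ weightProd A y g m ω :=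
  Finset.prod_nonneg fun i _ => weight_nonneg hg i ω

section Pathwise

variable [Fintype S]

/-- The sum of the centred samples `f (y i) - p^⊤ f` over the visits before time `m`. -/
noncomputable def centredSum (U : ℕ → Set Ω) (y : ℕ → Ω → S) (p : S → ℝ) (f : S → ℝ) (m : ℕ)
    (ω : Ω) : ℝ :=
  ∑ i ∈ Finset.range m, (U i).indicator (fun ω => f (y i ω) - expect p f) ω

lemma centredSum_sub (f g : S → ℝ) (m : ℕ) (ω : Ω) :
    centredSum U y p (fun s => f s - g s) m ω
      = centredSum U y p f m ω - centredSum U y p g m ω := by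
  rw [centredSum, centredSum, centredSum, ← Finset.sum_sub_distrib]
  refine Finset.sum_congr rfl fun i _ => ?_
  by_cases h : ω ∈ U i <;> simp [h, expect_sub]; ring

lemma centredSum_const (hp : p ∈ stdSimplex ℝ S) (c : ℝ) (m : ℕ) (ω : Ω) :
    centredSum U y p (fun _ => c) m ω = 0 :=
  Finset.sum_eq_zero fun i _ => by simp [expect_const hp]

lemma centredSum_neg (f : S → ℝ) (m : ℕ) (ω : Ω) :
    centredSum U y p (fun s => -f s) m ω = -centredSum U y p f m ω := by
  have h := centredSum_sub (U := U) (y := y) (p := p) (fun _ => 0) f m ω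
  have h0 : centredSum U y p (fun _ => 0) m ω = 0 :=
    Finset.sum_eq_zero fun i _ => by simp [expect]
  simpa [h0] using h

lemma indicator_comp_eq_sum (g : S → ℝ) (i : ℕ) (ω : Ω) :
    g (y i ω) = ∑ s, g s * Set.indicator {ω | y i ω = s} (fun _ => (1 : ℝ)) ω := by
  classical
  simp [Set.indicator_apply]

lemma weightProd_le {g : S → ℝ} (hg : ∀ s, 0 ≤ g s) (m : ℕ) (ω : Ω) :
    weightProd A y g m ω ≤ (1 + ∑ s, g s) ^ m := by
  have h0 : 0 ≤ ∑ s, g s := Finset.sum_nonneg fun s _ => hg s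
  refine (Finset.prod_le_prod (fun i _ => weight_nonneg hg i ω) (g := fun _ => 1 + ∑ s, g s)
    fun i _ => ?_).trans (by simp)
  have h1 : g (y i ω) ≤ ∑ s, g s := Finset.single_le_sum (fun s _ => hg s) (Finset.mem_univ _)
  by_cases h : ω ∈ A i <;> simp [h] <;> linarith

end Pathwise

variable [mΩ : MeasurableSpace Ω]

/-- At the times `i < N` that belong to the predictable visit set `U i`, the variable `y i` is
drawn from `p` conditionally on the past `𝒢 i`. -/
structure SampledFrom (μ : Measure Ω) (𝒢 : Filtration ℕ mΩ) (N : ℕ) (U : ℕ → Set Ω)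
    (y : ℕ → Ω → S) (p : S → ℝ) : Prop where
  measurable_visit : ∀ i < N, MeasurableSet[𝒢 i] (U i)
  measurable_next : ∀ i < N, ∀ s, MeasurableSet[𝒢 (i + 1)] {ω | y i ω = s}
  condExp_next : ∀ i < N, ∀ s, ∀ᵐ ω ∂μ, ω ∈ U i →
    (μ[Set.indicator {ω | y i ω = s} (fun _ => (1 : ℝ)) | 𝒢 i]) ω = p s

variable {μ : Measure Ω} {𝒢 : Filtration ℕ mΩ} {N : ℕ}

lemma SampledFrom.integral_mul_indicator [IsFiniteMeasure μ] (h : SampledFrom μ 𝒢 N U y p)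
    {i : ℕ} (hi : i < N) {Z : Ω → ℝ} (hZ : StronglyMeasurable[𝒢 i] Z) (hZi : Integrable Z μ)
    (hZU : ∀ ω, ω ∉ U i → Z ω = 0) (s : S) :
    ∫ ω, Z ω * Set.indicator {ω | y i ω = s} (fun _ => (1 : ℝ)) ω ∂μ = p s * ∫ ω, Z ω ∂μ := by
  have hms : MeasurableSet {ω | y i ω = s} := 𝒢.le _ _ (h.measurable_next i hi s)
  have hI : Integrable (Set.indicator {ω | y i ω = s} (fun _ => (1 : ℝ))) μ :=
    (integrable_const 1).indicator hms
  have hZI : Integrable (Z * Set.indicator {ω | y i ω = s} (fun _ => (1 : ℝ))) μ := by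
    have : Z * Set.indicator {ω | y i ω = s} (fun _ => (1 : ℝ))
        = Set.indicator {ω | y i ω = s} Z := by
      ext ω; by_cases hω : y i ω = s <;> simp [hω]
    rw [this]; exact hZi.indicator hms
  have h1 := condExp_mul_of_stronglyMeasurable_left hZ hZI hI
  calc ∫ ω, Z ω * Set.indicator {ω | y i ω = s} (fun _ => (1 : ℝ)) ω ∂μ
      = ∫ ω, (μ[Z * Set.indicator {ω | y i ω = s} (fun _ => (1 : ℝ)) | 𝒢 i]) ω ∂μ :=
        (integral_condExp (𝒢.le i)).symm
    _ = ∫ ω, p s * Z ω ∂μ := by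
        refine integral_congr_ae ?_
        filter_upwards [h1, h.condExp_next i hi s] with ω h2 h3
        rw [h2, Pi.mul_apply]
        by_cases hω : ω ∈ U i
        · rw [h3 hω, mul_comm]
        · rw [hZU ω hω]; simp
    _ = p s * ∫ ω, Z ω ∂μ := integral_const_mul _ _

variable [Fintype S]

lemma SampledFrom.stronglyMeasurable_comp (h : SampledFrom μ 𝒢 N U y p) (g : S → ℝ) {i : ℕ}
    (hi : i < N) : StronglyMeasurable[𝒢 (i + 1)] (fun ω => g (y i ω)) := by
  simp_rw [indicator_comp_eq_sum g]
  exact Finset.stronglyMeasurable_fun_sum _ fun s _ =>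
    (stronglyMeasurable_const.indicator (h.measurable_next i hi s)).const_mul _

lemma SampledFrom.stronglyMeasurable_weightProd (h : SampledFrom μ 𝒢 N U y p)
    (hA : ∀ i < N, MeasurableSet[𝒢 i] (A i)) (g : S → ℝ) {m : ℕ} (hm : m ≤ N) :
    StronglyMeasurable[𝒢 m] (weightProd A y g m) := by
  refine Finset.stronglyMeasurable_fun_prod _ fun i hi => ?_
  have him : i < m := Finset.mem_range.1 hi
  refine StronglyMeasurable.mono ?_ (𝒢.mono (Nat.succ_le_of_lt him))
  exact stronglyMeasurable_const.add
    (((h.stronglyMeasurable_comp g (him.trans_le hm)).sub stronglyMeasurable_const).indicator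
      (𝒢.mono (Nat.le_succ i) _ (hA i (him.trans_le hm))))

lemma SampledFrom.integrable_weightProd [IsFiniteMeasure μ] (h : SampledFrom μ 𝒢 N U y p)
    (hA : ∀ i < N, MeasurableSet[𝒢 i] (A i)) {g : S → ℝ} (hg : ∀ s, 0 ≤ g s) {m : ℕ}
    (hm : m ≤ N) : Integrable (weightProd A y g m) μ := by
  refine Integrable.of_bound
    (((h.stronglyMeasurable_weightProd hA g hm).mono (𝒢.le m)).aestronglyMeasurable)
    ((1 + ∑ s, g s) ^ m) (ae_of_all _ fun ω => ?_)
  rw [Real.norm_of_nonneg (weightProd_nonneg hg m ω)]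
  exact weightProd_le hg m ω

/-- Factors whose mean under `p` is at most `1`, used at predictable times among the visits, have
a product whose mean is at most `1`. -/
lemma SampledFrom.integral_weightProd_le_one [IsProbabilityMeasure μ]
    (h : SampledFrom μ 𝒢 N U y p) (hA : ∀ i < N, MeasurableSet[𝒢 i] (A i))
    (hAU : ∀ i < N, A i ⊆ U i) {g : S → ℝ} (hg : ∀ s, 0 ≤ g s) (hpg : ∑ s, p s * g s ≤ 1)
    {m : ℕ} (hm : m ≤ N) : ∫ ω, weightProd A y g m ω ∂μ ≤ 1 := by
  induction m with
  | zero => simp [weightProd]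
  | succ m ih =>
    have hmN : m < N := hm
    refine le_trans ?_ (ih hmN.le)
    set P := weightProd A y g m with hP
    have hPi : Integrable P μ := h.integrable_weightProd hA hg hmN.le
    set Z : Ω → ℝ := (A m).indicator P with hZ
    have hZm : StronglyMeasurable[𝒢 m] Z :=
      (h.stronglyMeasurable_weightProd hA g hmN.le).indicator (hA m hmN)
    have hZi : Integrable Z μ := hPi.indicator (𝒢.le m _ (hA m hmN))
    have hZ0 : 0 ≤ ∫ ω, Z ω ∂μ := integral_nonneg fun ω =>
      Set.indicator_nonneg (fun ω _ => weightProd_nonneg hg m ω) ω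
    have hsplit : ∀ ω, weightProd A y g (m + 1) ω = P ω +
        (∑ s, g s * (Z ω * Set.indicator {ω | y m ω = s} (fun _ => (1 : ℝ)) ω) - Z ω) := by
      intro ω
      have h1 : ∑ s, g s * (Z ω * Set.indicator {ω | y m ω = s} (fun _ => (1 : ℝ)) ω)
          = Z ω * g (y m ω) := by
        rw [indicator_comp_eq_sum g m ω, Finset.mul_sum]
        exact Finset.sum_congr rfl fun s _ => by ring
      rw [h1, weightProd, Finset.prod_range_succ, ← weightProd, ← hP]
      by_cases hω : ω ∈ A m
      · simp only [hZ, hω, Set.indicator_of_mem]; ring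
      · simp [hZ, hω]
    have hterm : ∀ s, Integrable
        (fun ω => Z ω * Set.indicator {ω | y m ω = s} (fun _ => (1 : ℝ)) ω) μ := fun s => by
      have : (fun ω => Z ω * Set.indicator {ω | y m ω = s} (fun _ => (1 : ℝ)) ω)
          = Set.indicator {ω | y m ω = s} Z := by
        ext ω; by_cases hω : y m ω = s <;> simp [hω]
      rw [this]; exact hZi.indicator (𝒢.le _ _ (h.measurable_next m hmN s))
    have hsum : Integrable (fun ω => ∑ s, g s *
        (Z ω * Set.indicator {ω | y m ω = s} (fun _ => (1 : ℝ)) ω)) μ :=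
      integrable_finsetSum _ fun s _ => (hterm s).const_mul _
    simp_rw [hsplit]
    rw [integral_add (f := P) hPi
        (g := fun ω => ∑ s, g s * (Z ω * Set.indicator {ω | y m ω = s} (fun _ => (1 : ℝ)) ω) - Z ω)
        (hsum.sub hZi), integral_sub hsum hZi,
      integral_finsetSum _ fun s _ => (hterm s).const_mul _]
    simp_rw [integral_const_mul]
    have hU : ∀ ω, ω ∉ U m → Z ω = 0 := fun ω hω =>
      Set.indicator_of_notMem (fun hA' => hω (hAU m hmN hA')) _
    simp_rw [h.integral_mul_indicator hmN hZm hZi hU]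
    have : ∑ s, g s * (p s * ∫ ω, Z ω ∂μ) = (∑ s, p s * g s) * ∫ ω, Z ω ∂μ := by
      rw [Finset.sum_mul]; exact Finset.sum_congr rfl fun s _ => by ring
    rw [this]
    nlinarith [mul_le_mul_of_nonneg_right hpg hZ0]

/-- Ville's inequality for the product of factors over the visits. -/
lemma SampledFrom.measure_exists_le_weightProd [IsProbabilityMeasure μ]
    (h : SampledFrom μ 𝒢 N U y p) {g : S → ℝ} (hg : ∀ s, 0 ≤ g s)
    (hpg : ∑ s, p s * g s ≤ 1) {C : ℝ} (hC : 0 < C) :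
    μ.real {ω | ∃ m ≤ N, C ≤ weightProd U y g m ω} ≤ C⁻¹ := by
  -- Stop the product once it has reached `C`: the stopped product keeps its value until time `N`.
  set A : ℕ → Set Ω := fun i => U i ∩ {ω | ∀ j ∈ Finset.range (i + 1), weightProd U y g j ω < C}
    with hA
  have hAm : ∀ i < N, MeasurableSet[𝒢 i] (A i) := fun i hi => by
    refine (h.measurable_visit i hi).inter ?_
    rw [Set.ofPred_forall]
    refine MeasurableSet.iInter fun j => ?_
    rw [Set.ofPred_forall]
    refine MeasurableSet.iInter fun hj => ?_
    have hji : j ≤ i := Nat.lt_succ_iff.1 (Finset.mem_range.1 hj)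
    exact ((h.stronglyMeasurable_weightProd h.measurable_visit g
      (hji.trans hi.le)).mono (𝒢.mono hji)).measurable measurableSet_Iio
  have hreach : {ω | ∃ m ≤ N, C ≤ weightProd U y g m ω} ⊆ {ω | C ≤ weightProd A y g N ω} := by
    intro ω hω
    classical
    have hω' : ∃ m, C ≤ weightProd U y g m ω := let ⟨m, _, hm⟩ := hω; ⟨m, hm⟩
    set m := Nat.find hω' with hm
    have hmN : m ≤ N := by
      obtain ⟨m', hm', hC'⟩ := hω
      exact (Nat.find_min' hω' hC').trans hm'
    have hlt : ∀ j < m, weightProd U y g j ω < C := fun j hj => not_le.1 (Nat.find_min hω' hj)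
    have hge : C ≤ weightProd U y g m ω := Nat.find_spec hω'
    have h1 : weightProd A y g m ω = weightProd U y g m ω := by
      refine Finset.prod_congr rfl fun i hi => ?_
      have hiff : ω ∈ A i ↔ ω ∈ U i := ⟨fun h => h.1, fun hu => ⟨hu, fun j hj => hlt j
        (lt_of_le_of_lt (Nat.lt_succ_iff.1 (Finset.mem_range.1 hj)) (Finset.mem_range.1 hi))⟩⟩
      by_cases hu : ω ∈ U i
      · simp [hu, hiff.2 hu]
      · simp [hu, mt hiff.1 hu]
    have h2 : weightProd A y g N ω = weightProd A y g m ω := by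
      refine (Finset.prod_subset (Finset.range_mono hmN) fun i _ hi => ?_).symm
      have hmi : m ≤ i := not_lt.1 fun h => hi (Finset.mem_range.2 h)
      have : ω ∉ A i := fun ha =>
        absurd hge (not_le.2 (ha.2 m (Finset.mem_range.2 (Nat.lt_succ_of_le hmi))))
      simp [this]
    simpa [h2, h1] using hge
  refine (measureReal_mono hreach).trans ?_
  have hint := h.integrable_weightProd hAm hg le_rfl
  have h1 := mul_meas_ge_le_integral_of_nonneg (ae_of_all μ fun ω => weightProd_nonneg hg N ω)
    hint C
  have h2 := h.integral_weightProd_le_one hAm (fun i _ => Set.inter_subset_left) hg hpg le_rfl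
  rw [← one_div, le_div_iff₀ hC, mul_comm]
  exact h1.trans h2

/-- Bernstein's inequality along a tangent line: one event of small probability controls all
visit counts. -/
lemma SampledFrom.measure_line_le [IsProbabilityMeasure μ] (hp : p ∈ stdSimplex ℝ S)
    (h : SampledFrom μ 𝒢 N U y p) {f : S → ℝ} {b v θ : ℝ} (hf : ∀ s, f s - expect p f ≤ b)
    (hv : variance p f ≤ v) (hb : 0 ≤ b) (hθ : 0 < θ) (x : ℝ) :
    μ.real {ω | ∃ m ≤ N, (visitCount U m ω : ℝ) * v * θ / 2 + x / θ + b * x / 3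
      < centredSum U y p f m ω} ≤ Real.exp (-x) := by
  set r : ℝ := θ / (1 + b * θ / 3) with hr
  have hd : 0 < 1 + b * θ / 3 := by positivity
  have hr0 : 0 < r := by positivity
  set g : S → ℝ := fun s => Real.exp (r * (f s - expect p f - v * θ / 2)) with hg
  have hprod : ∀ m ω, weightProd U y g m ω
      = Real.exp (r * (centredSum U y p f m ω - (visitCount U m ω : ℝ) * v * θ / 2)) := by
    intro m ω
    have : r * (centredSum U y p f m ω - (visitCount U m ω : ℝ) * v * θ / 2)
        = ∑ i ∈ Finset.range m,
          (U i).indicator (fun ω => r * (f (y i ω) - expect p f - v * θ / 2)) ω := by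
      rw [centredSum, visitCount, Nat.cast_sum, mul_assoc, mul_div_assoc, Finset.sum_mul,
        ← Finset.sum_sub_distrib, Finset.mul_sum]
      refine Finset.sum_congr rfl fun i _ => ?_
      by_cases hu : ω ∈ U i <;> simp [hu]
    rw [this, Real.exp_sum]
    refine Finset.prod_congr rfl fun i _ => ?_
    by_cases hu : ω ∈ U i <;> simp [hu, hg]
  have hV := h.measure_exists_le_weightProd (g := g) (fun s => (Real.exp_pos _).le)
    (sum_mul_exp_le_one hp hf hv hb hθ) (Real.exp_pos x)
  rw [← Real.exp_neg] at hV
  refine le_trans (measureReal_mono ?_) hV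
  rintro ω ⟨m, hm, hlt⟩
  refine ⟨m, hm, ?_⟩
  rw [hprod, Real.exp_le_exp]
  have hx : x = r * (x / θ + b * x / 3) := by
    rw [hr]; field_simp
  rw [hx]
  exact mul_le_mul_of_nonneg_left (by linarith) hr0.le

/-- Bernstein's inequality at a fixed visit count `n`. -/
lemma SampledFrom.measure_fixed_count_le [IsProbabilityMeasure μ] (hp : p ∈ stdSimplex ℝ S)
    (h : SampledFrom μ 𝒢 N U y p) {f : S → ℝ} {b v x : ℝ} (hf : ∀ s, f s - expect p f ≤ b)
    (hv : variance p f ≤ v) (hb : 0 ≤ b) (hx : 0 < x) {n : ℕ} (hn : 1 ≤ n) :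
    μ.real {ω | ∃ m ≤ N, visitCount U m ω = n ∧
      √(2 * n * v * x) + b * x / 3 < centredSum U y p f m ω} ≤ Real.exp (-x) := by
  have hn0 : (0 : ℝ) < n := by exact_mod_cast hn
  rcases ((variance_nonneg hp f).trans hv).eq_or_lt with hv0 | hv0
  · -- For `v = 0` the optimal slope is infinite: approach it through integer slopes.
    subst hv0
    set E : ℕ → Set Ω := fun k => {ω | ∃ m ≤ N, visitCount U m ω = n ∧
      x / ((k : ℝ) + 1) + b * x / 3 < centredSum U y p f m ω} with hE
    have hmono : Monotone E := fun k l hkl ω ⟨m, hm, hc, hlt⟩ => ⟨m, hm, hc, lt_of_le_of_lt (by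
      have : (k : ℝ) ≤ l := by exact_mod_cast hkl
      gcongr) hlt⟩
    have hsub : {ω | ∃ m ≤ N, visitCount U m ω = n ∧
        √(2 * n * 0 * x) + b * x / 3 < centredSum U y p f m ω} ⊆ ⋃ k, E k := by
      rintro ω ⟨m, hm, hc, hlt⟩
      simp only [mul_zero, zero_mul, Real.sqrt_zero, zero_add] at hlt
      obtain ⟨k, hk⟩ := exists_nat_gt (x / (centredSum U y p f m ω - b * x / 3))
      rw [div_lt_iff₀ (by linarith)] at hk
      refine Set.mem_iUnion.2 ⟨k, m, hm, hc, ?_⟩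
      have : x / ((k : ℝ) + 1) < centredSum U y p f m ω - b * x / 3 := by
        rw [div_lt_iff₀ (by positivity)]; linarith
      linarith
    have hbound : ∀ k, μ (E k) ≤ ENNReal.ofReal (Real.exp (-x)) := fun k => by
      rw [← ofReal_measureReal]
      refine ENNReal.ofReal_le_ofReal (le_trans (measureReal_mono ?_)
        (h.measure_line_le hp hf hv hb (θ := (k : ℝ) + 1) (by positivity) x))
      rintro ω ⟨m, hm, _, hlt⟩
      exact ⟨m, hm, by simpa using hlt⟩
    refine ENNReal.toReal_le_of_le_ofReal (Real.exp_pos _).le ((measure_mono hsub).trans ?_)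
    rw [hmono.measure_iUnion]
    exact iSup_le hbound
  · set w : ℝ := √(2 * n * v * x) with hw
    have hpos : 0 < 2 * n * v * x := by positivity
    have hw0 : 0 < w := Real.sqrt_pos.2 hpos
    have hw2 : w ^ 2 = 2 * n * v * x := Real.sq_sqrt hpos.le
    refine le_trans (measureReal_mono ?_)
      (h.measure_line_le hp hf hv hb (θ := 2 * x / w) (by positivity) x)
    rintro ω ⟨m, hm, hc, hlt⟩
    refine ⟨m, hm, ?_⟩
    have h1 : (n : ℝ) * v * (2 * x / w) / 2 = w / 2 := by
      field_simp; linarith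
    have h2 : x / (2 * x / w) = w / 2 := by field_simp
    rw [hc, h1, h2]; linarith

/-- Bernstein's inequality for all visit counts at once, by a union bound over the count. -/
lemma SampledFrom.measure_all_counts_le [IsProbabilityMeasure μ] (hp : p ∈ stdSimplex ℝ S)
    (h : SampledFrom μ 𝒢 N U y p) {f : S → ℝ} {b v x : ℝ} (hf : ∀ s, f s - expect p f ≤ b)
    (hv : variance p f ≤ v) (hb : 0 ≤ b) (hx : 0 < x) :
    μ.real {ω | ∃ m ≤ N, 1 ≤ visitCount U m ω ∧
      √(2 * visitCount U m ω * v * x) + b * x / 3 < centredSum U y p f m ω}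
      ≤ N * Real.exp (-x) := by
  have hsub : {ω | ∃ m ≤ N, 1 ≤ visitCount U m ω ∧
      √(2 * visitCount U m ω * v * x) + b * x / 3 < centredSum U y p f m ω} ⊆
      ⋃ n ∈ Finset.Icc 1 N, {ω | ∃ m ≤ N, visitCount U m ω = n ∧
        √(2 * n * v * x) + b * x / 3 < centredSum U y p f m ω} := by
    rintro ω ⟨m, hm, h1, hlt⟩
    exact Set.mem_iUnion₂.2 ⟨visitCount U m ω,
      Finset.mem_Icc.2 ⟨h1, (visitCount_le U m ω).trans hm⟩, m, hm, rfl, hlt⟩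
  refine (measureReal_mono hsub (measure_ne_top _ _)).trans
    ((measureReal_biUnion_finset_le _ _).trans ?_)
  refine (Finset.sum_le_card_nsmul _ _ (Real.exp (-x)) fun n hn => ?_).trans (by simp)
  exact h.measure_fixed_count_le hp hf hv hb hx (Finset.mem_Icc.1 hn).1

end Sampling

/-! ### Bernstein's inequality for a slowly varying family of functions -/

lemma mem_Icc_of_increments {S : Type*} {F : ℕ → S → ℝ}
    (hF : ∀ r s, F r s ≤ F (r + 1) s ∧ F (r + 1) s ≤ F r s + 1) (r k : ℕ) (s : S) :
    F (r + k) s - F r s ∈ Set.Icc (0 : ℝ) k := by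
  induction k with
  | zero => simp
  | succ k ih =>
    have h := hF (r + k) s
    rw [← add_assoc]
    push_cast
    exact ⟨by linarith [ih.1], by linarith [ih.2]⟩

lemma two_le_of_log_two_mul_le {N : ℕ} {ℓ : ℝ} (hN : 4 ≤ N) (hℓ : Real.log (2 * N) ≤ ℓ) :
    2 ≤ ℓ := by
  have h8 : Real.log 8 ≤ Real.log (2 * N) := by
    have : (4 : ℝ) ≤ N := by exact_mod_cast hN
    exact Real.log_le_log (by norm_num) (by linarith)
  have : Real.log 8 = 3 * Real.log 2 := by
    rw [show (8 : ℝ) = 2 ^ 3 by norm_num, Real.log_pow]; norm_num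
  linarith [Real.log_two_gt_d9]

/-- With `r = √(n v)` and `c = √ℓ`, the line `n v θ / 2 + ℓ / θ + H ℓ / 3` is tangent to the curve
`√2 c r + H ℓ / 3` at `r = √2 c / θ`. For `θ = 2 / ((2 j + 1) H)`, the points of tangency are the
odd multiples of `H c / √2`, and the line for the nearest of them exceeds the curve by at most
`2 H ℓ / 3`. -/
lemma line_le_sqrt_curve {H c r : ℝ} (hH : 0 < H) (hc : 0 < c) (hr : 0 ≤ r) {j : ℕ}
    (hj : j = ⌊√2 * r / (H * c) / 2⌋₊) :
    r ^ 2 * (2 / ((2 * j + 1) * H)) / 2 + c ^ 2 / (2 / ((2 * j + 1) * H)) + H * c ^ 2 / 3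
      ≤ √2 * c * r + H * c ^ 2 := by
  set z : ℝ := √2 * r / (H * c) with hz
  have hz0 : 0 ≤ z := by positivity
  have h2 : √2 * √2 = (2 : ℝ) := Real.mul_self_sqrt (by norm_num)
  have hrz : √2 * r = H * c * z := by rw [hz]; field_simp
  have hr2 : r ^ 2 = H ^ 2 * c ^ 2 * z ^ 2 / 2 := by
    have : (√2 * r) ^ 2 = (H * c * z) ^ 2 := by rw [hrz]
    rw [mul_pow, pow_two √2, h2] at this; linarith
  have h1 : (j : ℝ) ≤ z / 2 := hj ▸ Nat.floor_le (by positivity)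
  have h3 : z / 2 < j + 1 := hj ▸ Nat.lt_floor_add_one _
  have hj0 : (0 : ℝ) ≤ j := j.cast_nonneg
  have hd : (0 : ℝ) < 2 * j + 1 := by positivity
  have hsq : (z - (2 * j + 1)) ^ 2 ≤ 1 := by
    rw [sq_le_one_iff_abs_le_one, abs_le]; constructor <;> linarith
  have key : z ^ 2 / (2 * (2 * j + 1)) + (2 * j + 1) / 2 ≤ z + 2 / 3 := by
    have : z ^ 2 / (2 * (2 * j + 1)) ≤ z + 2 / 3 - (2 * j + 1) / 2 := by
      rw [div_le_iff₀ (by positivity)]; nlinarith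
    linarith
  have e1 : r ^ 2 * (2 / ((2 * j + 1) * H)) / 2 + c ^ 2 / (2 / ((2 * j + 1) * H))
      = H * c ^ 2 * (z ^ 2 / (2 * (2 * j + 1)) + (2 * j + 1) / 2) := by
    rw [hr2]; field_simp
  have e2 : √2 * c * r = H * c ^ 2 * z := by
    calc _ = c * (√2 * r) := by ring
      _ = _ := by rw [hrz]; ring
  have := mul_le_mul_of_nonneg_left key (show 0 ≤ H * c ^ 2 by positivity)
  rw [e1, e2]; linarith

section Family

variable {S Ω : Type*} [Fintype S] [mΩ : MeasurableSpace Ω]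
  {μ : Measure Ω} {𝒢 : Filtration ℕ mΩ} {N : ℕ} {U : ℕ → Set Ω} {y : ℕ → Ω → S} {p : S → ℝ}

/-- Bernstein's inequality, simultaneously for all visit counts and for a family of functions
`F 0 = 0, F 1, F 2, …` with increments in `[0, 1]`, without a loss in the leading term.

Only every `(⌊h⌋ + 1)`-th function is treated with the leading term; the increment from there has
range at most `h`, where `h` is of order `H √(ℓ / N)`, so that its deviation, even at level `2 ℓ`,
and its effect on the standard deviation are of order `H ℓ`. For the functions that are treated,
the curve `√(2 n v ℓ) + H ℓ / 3`, raised by `2 H ℓ / 3`, lies nowhere below the lowest of finitely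
many of its tangent lines, which Ville's inequality controls for all counts `n` at once. Both grids
have size of order `√(N / ℓ)`, and fewer than `N` events of probability `e^{-ℓ}` are needed. -/
lemma SampledFrom.measure_family_le [IsProbabilityMeasure μ] (hp : p ∈ stdSimplex ℝ S)
    (h : SampledFrom μ 𝒢 N U y p) {F : ℕ → S → ℝ} (hF0 : ∀ s, F 0 s = 0)
    (hF : ∀ r s, F r s ≤ F (r + 1) s ∧ F (r + 1) s ≤ F r s + 1) {H : ℕ} (hH : 1 ≤ H)
    (hHN : H ≤ N) (hN : 4 ≤ N) {ℓ : ℝ} (hℓ : Real.log (2 * N) ≤ ℓ) :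
    μ.real {ω | ∃ m ≤ N, ∃ r < H,
      √(2 * visitCount U m ω * variance p (F r) * ℓ) + 3 * H * ℓ
        < centredSum U y p (F r) m ω} ≤ N * Real.exp (-ℓ) := by
  have hℓ2 : 2 ≤ ℓ := two_le_of_log_two_mul_le hN hℓ
  have hH0 : (0 : ℝ) < H := by exact_mod_cast hH
  have hHN' : (H : ℝ) ≤ N := by exact_mod_cast hHN
  have hN4 : (4 : ℝ) ≤ N := by exact_mod_cast hN
  have hN0 : (0 : ℝ) < N := by linarith
  have hℓ0 : 0 < ℓ := by linarith
  set a : ℝ := √(N : ℝ) with ha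
  set c : ℝ := √ℓ with hc
  have ha0 : 0 < a := Real.sqrt_pos.2 hN0
  have hc0 : 0 < c := Real.sqrt_pos.2 hℓ0
  have ha2 : a ^ 2 = N := Real.sq_sqrt hN0.le
  have hc2 : c ^ 2 = ℓ := Real.sq_sqrt hℓ0.le
  set q : ℝ := a / c with hq
  have hq0 : 0 < q := by positivity
  set d : ℝ := 3 / 4 * H / q with hd
  have hd0 : 0 < d := by positivity
  set ρ : ℕ := ⌊d⌋₊ with hρ
  have hρd : (ρ : ℝ) ≤ d := Nat.floor_le hd0.le
  have hdρ : d < ρ + 1 := Nat.lt_floor_add_one d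
  set B : ℕ := (H - 1) / (ρ + 1) with hB
  set G : ℕ := ⌊3 / 8 * q⌋₊ with hG
  set base : ℕ → ℕ := fun r => (ρ + 1) * (r / (ρ + 1)) with hbase
  have hF_mem : ∀ (r : ℕ) s, F r s ∈ Set.Icc (0 : ℝ) r := fun r s => by
    simpa [hF0] using mem_Icc_of_increments hF 0 r s
  have hD_mem : ∀ r s, F r s - F (base r) s ∈ Set.Icc (0 : ℝ) (r % (ρ + 1) : ℕ) := fun r s => by
    have := mem_Icc_of_increments hF (base r) (r % (ρ + 1)) s
    rwa [hbase, Nat.div_add_mod] at this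
  have hmod : ∀ r, ((r % (ρ + 1) : ℕ) : ℝ) ≤ d := fun r => le_trans (by
    exact_mod_cast Nat.lt_succ_iff.1 (Nat.mod_lt r ρ.succ_pos)) hρd
  have hD_var : ∀ r, variance p (fun s => F r s - F (base r) s) ≤ (d / 2) ^ 2 := fun r =>
    (variance_le_of_mem_Icc hp (a := 0) (b := d)
      fun s => ⟨(hD_mem r s).1, (hD_mem r s).2.trans (hmod r)⟩).trans (by simp)
  -- The increments from the base functions, at the confidence level `2 ℓ`. The slope parameter
  -- `16 / (3 H)` is optimal for the largest count `N` and the variance bound `(d / 2) ^ 2`.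
  set E₁ : ℕ → Set Ω := fun r => {ω | ∃ m ≤ N,
    (visitCount U m ω : ℝ) * (d / 2) ^ 2 * (16 / (3 * H)) / 2 + 2 * ℓ / (16 / (3 * H))
      + H * (2 * ℓ) / 3 < centredSum U y p (fun s => F r s - F (base r) s) m ω} with hE₁
  -- The base functions, on the grid of tangent lines.
  set E₂ : ℕ × ℕ → Set Ω := fun ij => {ω | ∃ m ≤ N,
    (visitCount U m ω : ℝ) * variance p (F ((ρ + 1) * ij.1)) * (2 / ((2 * ij.2 + 1) * H)) / 2
      + ℓ / (2 / ((2 * ij.2 + 1) * H)) + H * ℓ / 3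
        < centredSum U y p (F ((ρ + 1) * ij.1)) m ω} with hE₂
  have hE₁_le : ∀ r ∈ Finset.range H, μ.real (E₁ r) ≤ Real.exp (-(2 * ℓ)) := fun r hr => by
    refine h.measure_line_le hp (fun s => ?_) (hD_var r) hH0.le (by positivity) _
    have h1 := le_expect hp fun s => (hD_mem r s).1
    have h2 : ((r % (ρ + 1) : ℕ) : ℝ) ≤ H := by
      exact_mod_cast (Nat.mod_le _ _).trans (Finset.mem_range.1 hr).le
    linarith [(hD_mem r s).2]
  have hbase_le : ∀ i ≤ B, (ρ + 1) * i ≤ H := fun i hi =>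
    ((Nat.mul_le_mul_left _ hi).trans (Nat.mul_div_le _ _)).trans (Nat.sub_le _ _)
  have hE₂_le : ∀ ij ∈ Finset.Icc 1 B ×ˢ Finset.range (G + 1), μ.real (E₂ ij) ≤ Real.exp (-ℓ) :=
    fun ij hij => by
    have hi := (Finset.mem_Icc.1 (Finset.mem_product.1 hij).1).2
    refine h.measure_line_le hp (fun s => ?_) le_rfl hH0.le (by positivity) _
    have h1 := le_expect hp fun s => (hF_mem ((ρ + 1) * ij.1) s).1
    have h2 : (((ρ + 1) * ij.1 : ℕ) : ℝ) ≤ H := by exact_mod_cast hbase_le _ hi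
    linarith [(hF_mem ((ρ + 1) * ij.1) s).2]
  have hsub : {ω | ∃ m ≤ N, ∃ r < H,
      √(2 * visitCount U m ω * variance p (F r) * ℓ) + 3 * H * ℓ
        < centredSum U y p (F r) m ω} ⊆
      (⋃ r ∈ Finset.range H, E₁ r) ∪ ⋃ ij ∈ Finset.Icc 1 B ×ˢ Finset.range (G + 1), E₂ ij := by
    rintro ω ⟨m, hm, r, hr, hlt⟩
    by_contra hω
    simp only [Set.mem_union, not_or, Set.mem_iUnion, not_exists] at hω
    obtain ⟨hω₁, hω₂⟩ := hω
    have h1 : centredSum U y p (fun s => F r s - F (base r) s) m ω ≤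
        (visitCount U m ω : ℝ) * (d / 2) ^ 2 * (16 / (3 * H)) / 2 + 2 * ℓ / (16 / (3 * H))
          + H * (2 * ℓ) / 3 := not_lt.1 fun hlt' => hω₁ r (Finset.mem_range.2 hr) ⟨m, hm, hlt'⟩
    set n : ℝ := (visitCount U m ω : ℝ) with hn
    have hn0 : 0 ≤ n := Nat.cast_nonneg _
    have hnN : n ≤ N := Nat.cast_le.2 ((visitCount_le U m ω).trans hm)
    have hsn : √n ≤ a := Real.sqrt_le_sqrt hnN
    have hqd : a * d = 3 / 4 * H * c := by rw [hd, hq]; field_simp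
    have hcurve : ∀ v, √(2 * n * v * ℓ) = √2 * c * (√n * √v) := fun v => by
      rw [show 2 * n * v * ℓ = 2 * ℓ * (n * v) by ring, Real.sqrt_mul (by positivity),
        Real.sqrt_mul (by norm_num), Real.sqrt_mul hn0]
    have h1' : centredSum U y p (fun s => F r s - F (base r) s) m ω
        ≤ (3 / 4 + 2 / 3) * (H * ℓ) := by
      have hNd : n * d ^ 2 ≤ 9 / 16 * H ^ 2 * ℓ := by
        calc n * d ^ 2 ≤ a ^ 2 * d ^ 2 := by rw [ha2]; gcongr
          _ = (a * d) ^ 2 := by ring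
          _ = _ := by rw [hqd, ← hc2]; ring
      have e1 : n * (d / 2) ^ 2 * (16 / (3 * H)) / 2 = 2 / (3 * H) * (n * d ^ 2) := by
        field_simp; ring
      have e2 : 2 / (3 * (H : ℝ)) * (9 / 16 * H ^ 2 * ℓ) = 3 / 8 * (H * ℓ) := by
        field_simp; ring
      have e3 : 2 * ℓ / (16 / (3 * (H : ℝ))) = 3 / 8 * (H * ℓ) := by field_simp; ring
      have := mul_le_mul_of_nonneg_left hNd (show 0 ≤ 2 / (3 * (H : ℝ)) by positivity)
      rw [e1, e3] at h1
      linarith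
    have h2 : centredSum U y p (F (base r)) m ω
        ≤ √2 * c * (√n * √(variance p (F (base r)))) + H * ℓ := by
      rcases Nat.eq_zero_or_pos (r / (ρ + 1)) with hi | hi
      · -- The first base function vanishes and needs no event.
        have : F (base r) = fun _ => 0 := by
          ext s; simp [hbase, hi, hF0]
        rw [this, centredSum_const hp]
        positivity
      · have hiB : r / (ρ + 1) ≤ B := Nat.div_le_div_right (Nat.le_sub_one_of_lt hr)
        set x : ℝ := √n * √(variance p (F (base r))) with hx
        have hx0 : 0 ≤ x := by positivity
        have hxle : x ≤ a * (H / 2) := by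
          refine mul_le_mul hsn ?_ (Real.sqrt_nonneg _) ha0.le
          rw [Real.sqrt_le_left (by positivity)]
          have hbH : ((base r : ℕ) : ℝ) ≤ H := by exact_mod_cast hbase_le _ hiB
          have := variance_le_of_mem_Icc hp (a := 0) (b := H)
            fun s => ⟨(hF_mem _ s).1, (hF_mem _ s).2.trans hbH⟩
          rwa [sub_zero] at this
        set j : ℕ := ⌊√2 * x / (H * c) / 2⌋₊ with hj
        have hjG : j ≤ G := by
          refine Nat.floor_le_floor ?_
          have hs2 : √2 ≤ 3 / 2 := by rw [Real.sqrt_le_left (by norm_num)]; norm_num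
          calc √2 * x / (H * c) / 2 ≤ 3 / 2 * (a * (H / 2)) / (H * c) / 2 := by gcongr
            _ = 3 / 8 * q := by rw [hq]; field_simp; ring
        have h3 := not_lt.1 fun hlt' => hω₂ (r / (ρ + 1), j) (Finset.mem_product.2
          ⟨Finset.mem_Icc.2 ⟨hi, hiB⟩, Finset.mem_range.2 (Nat.lt_succ_of_le hjG)⟩) ⟨m, hm, hlt'⟩
        have h4 := line_le_sqrt_curve hH0 hc0 hx0 hj
        have hx2 : x ^ 2 = n * variance p (F (base r)) := by
          rw [hx, mul_pow, Real.sq_sqrt hn0, Real.sq_sqrt (variance_nonneg hp _)]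
        rw [hx2, hc2] at h4
        exact h3.trans h4
    have h5 : √(variance p (F (base r))) ≤ √(variance p (F r)) + d / 2 := by
      have e1 := (abs_le.1 (abs_sqrt_variance_sub_le hp (F r) (F (base r)))).1
      have e2 : √(variance p fun s => F r s - F (base r) s) ≤ d / 2 :=
        (Real.sqrt_le_left (by positivity)).2 (hD_var r)
      linarith
    have h6 : √2 * c * (√n * √(variance p (F (base r))))
        ≤ √2 * c * (√n * √(variance p (F r))) + 7 / 12 * (H * ℓ) := by
      have hs2 : √2 ≤ 14 / 9 := by rw [Real.sqrt_le_left (by norm_num)]; norm_num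
      calc √2 * c * (√n * √(variance p (F (base r))))
          ≤ √2 * c * (√n * (√(variance p (F r)) + d / 2)) := by gcongr
        _ = √2 * c * (√n * √(variance p (F r))) + √2 * c * (√n * (d / 2)) := by ring
        _ ≤ √2 * c * (√n * √(variance p (F r))) + 14 / 9 * c * (a * (d / 2)) := by gcongr
        _ = √2 * c * (√n * √(variance p (F r))) + 7 / 9 * c * (a * d) := by ring
        _ = _ := by rw [hqd, ← hc2]; ring
    have h7 := centredSum_sub (U := U) (y := y) (p := p) (F r) (F (base r)) m ω
    rw [hcurve] at hlt
    have : (0 : ℝ) < H * ℓ := by positivity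
    linarith
  have hexp : Real.exp (-ℓ) ≤ 1 / (2 * N) := by
    rw [Real.exp_neg, ← one_div]
    refine one_div_le_one_div_of_le (by positivity) ?_
    rw [← Real.log_le_iff_le_exp (by positivity)]; exact hℓ
  have hHexp : H * Real.exp (-(2 * ℓ)) ≤ 1 / 2 * Real.exp (-ℓ) := by
    have : H * Real.exp (-ℓ) ≤ 1 / 2 := by
      calc H * Real.exp (-ℓ) ≤ N * (1 / (2 * N)) := by gcongr
        _ = 1 / 2 := by field_simp
    calc H * Real.exp (-(2 * ℓ)) = H * Real.exp (-ℓ) * Real.exp (-ℓ) := by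
          rw [mul_assoc, ← Real.exp_add]; ring_nf
      _ ≤ _ := by gcongr
  have hBq : (B : ℝ) ≤ 4 / 3 * q := by
    calc (B : ℝ) ≤ ((H - 1 : ℕ) : ℝ) / ((ρ + 1 : ℕ) : ℝ) := Nat.cast_div_le
      _ ≤ H / d := by
        have : ((H - 1 : ℕ) : ℝ) ≤ H := by exact_mod_cast Nat.sub_le _ _
        have : d ≤ ((ρ + 1 : ℕ) : ℝ) := by push_cast; exact hdρ.le
        gcongr
      _ = 4 / 3 * q := by rw [hd]; field_simp
  have hGq : (G : ℝ) ≤ 3 / 8 * q := Nat.floor_le (by positivity)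
  have hcount : 1 / 2 + (B : ℝ) * (G + 1) ≤ N := by
    have h1 : (B : ℝ) * (G + 1) ≤ 4 / 3 * q * (3 / 8 * q + 1) := by gcongr
    have h2 : 2 * q ^ 2 ≤ N := by
      rw [hq, div_pow, ha2, hc2, ← mul_div_assoc, div_le_iff₀ hℓ0]; nlinarith
    nlinarith [sq_nonneg (3 * q - 4)]
  refine (measureReal_mono hsub (measure_ne_top _ _)).trans ((measureReal_union_le _ _).trans ?_)
  have b1 : μ.real (⋃ r ∈ Finset.range H, E₁ r) ≤ H * Real.exp (-(2 * ℓ)) :=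
    (measureReal_biUnion_finset_le _ _).trans
      ((Finset.sum_le_card_nsmul _ _ _ hE₁_le).trans (by simp))
  have b2 : μ.real (⋃ ij ∈ Finset.Icc 1 B ×ˢ Finset.range (G + 1), E₂ ij)
      ≤ B * (G + 1) * Real.exp (-ℓ) :=
    (measureReal_biUnion_finset_le _ _).trans
      ((Finset.sum_le_card_nsmul _ _ _ hE₂_le).trans (by simp))
  calc _ ≤ 1 / 2 * Real.exp (-ℓ) + B * (G + 1) * Real.exp (-ℓ) := by linarith
    _ = (1 / 2 + B * (G + 1)) * Real.exp (-ℓ) := by ring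
    _ ≤ _ := by gcongr

end Family

/-! ### The optimal value as a function of the number of remaining steps -/

section Bellman

variable {S A : Type*} [Fintype S]

section Recursion

variable [Fintype A] [Nonempty A]

/-- The optimal expected reward over `r` steps, by Bellman's recursion. As the decision process is
stationary, it does not depend on the timestep at which the `r` steps begin. -/
noncomputable def MDP.valueToGo (M : MDP S A) : ℕ → S → ℝ
  | 0, _ => 0
  | r + 1, s => Finset.univ.sup' Finset.univ_nonempty
      fun a => M.r s a + expect (M.p s a) (MDP.valueToGo M r)

lemma MDP.le_valueToGo_succ (M : MDP S A) (r : ℕ) (s : S) (a : A) :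
    M.r s a + expect (M.p s a) (M.valueToGo r) ≤ M.valueToGo (r + 1) s :=
  Finset.le_sup' (fun a => M.r s a + expect (M.p s a) (M.valueToGo r)) (Finset.mem_univ a)

lemma MDP.returnFrom_le_valueToGo (M : MDP S A) (π : S → ℕ → A) (r t : ℕ) (s : S) :
    M.returnFrom π r t s ≤ M.valueToGo r s := by
  induction r generalizing t s with
  | zero => exact le_rfl
  | succ r ih =>
    refine le_trans ?_ (M.le_valueToGo_succ r s (π s t))
    exact add_le_add_right (Finset.sum_le_sum fun s' _ =>
      mul_le_mul_of_nonneg_left (ih (t + 1) s') ((M.p_mem s _).1 s')) _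

lemma MDP.exists_returnFrom_eq_valueToGo (M : MDP S A) (T : ℕ) :
    ∃ π : S → ℕ → A, ∀ r t, t + r = T → ∀ s, M.returnFrom π r t s = M.valueToGo r s := by
  have h : ∀ r s, ∃ a, M.valueToGo (r + 1) s = M.r s a + expect (M.p s a) (M.valueToGo r) :=
    fun r s => by
      obtain ⟨a, -, ha⟩ := Finset.exists_mem_eq_sup' Finset.univ_nonempty
        fun a => M.r s a + expect (M.p s a) (M.valueToGo r)
      exact ⟨a, ha⟩
  choose act hact using h
  refine ⟨fun s u => act (T - u - 1) s, fun r => ?_⟩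
  induction r with
  | zero => intro t _ s; rfl
  | succ r ih =>
    intro t ht s
    have hr : T - t - 1 = r := by omega
    rw [hact r s, MDP.returnFrom, hr]
    congr 1
    exact Finset.sum_congr rfl fun s' _ => by rw [ih (t + 1) (by omega) s']

lemma MDP.optValue_eq_valueToGo (M : MDP S A) (t : ℕ) :
    M.optValue t = M.valueToGo (M.H + 1 - t) := by
  ext s
  obtain ⟨π, hπ⟩ := M.exists_returnFrom_eq_valueToGo (t + (M.H + 1 - t))
  refine le_antisymm (ciSup_le fun π => M.returnFrom_le_valueToGo π _ _ _) ?_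
  rw [← hπ _ t rfl s]
  exact le_ciSup (f := fun π => M.policyValue π t s)
    ⟨M.valueToGo (M.H + 1 - t) s, by rintro _ ⟨π, rfl⟩; exact M.returnFrom_le_valueToGo π _ _ _⟩ π

lemma MDP.valueToGo_increments (M : MDP S A) (r : ℕ) (s : S) :
    M.valueToGo r s ≤ M.valueToGo (r + 1) s ∧ M.valueToGo (r + 1) s ≤ M.valueToGo r s + 1 := by
  induction r generalizing s with
  | zero =>
    have h : ∀ a, M.r s a + expect (M.p s a) (M.valueToGo 0) = M.r s a := fun a => by
      simp [expect, MDP.valueToGo]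
    constructor
    · refine le_trans ?_ (M.le_valueToGo_succ 0 s (Classical.arbitrary A))
      rw [h]; exact (M.r_mem s _).1
    · refine Finset.sup'_le _ _ fun a _ => ?_
      rw [h]; simpa [MDP.valueToGo] using (M.r_mem s a).2
  | succ r ih =>
    constructor
    · refine Finset.sup'_le _ _ fun a _ => le_trans ?_ (M.le_valueToGo_succ (r + 1) s a)
      exact add_le_add_right (Finset.sum_le_sum fun s' _ =>
        mul_le_mul_of_nonneg_left (ih s').1 ((M.p_mem s a).1 s')) _
    · refine Finset.sup'_le _ _ fun a _ => ?_
      have h1 : expect (M.p s a) (M.valueToGo (r + 1)) ≤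
          expect (M.p s a) (M.valueToGo r) + 1 := by
        have := expect_sub (M.p s a) (M.valueToGo (r + 1)) (M.valueToGo r)
        have := expect_le (M.p_mem s a) (f := fun s => M.valueToGo (r + 1) s - M.valueToGo r s)
          (b := 1) fun s' => by linarith [(ih s').2]
        linarith
      linarith [M.le_valueToGo_succ r s a]

lemma MDP.valueToGo_mem_Icc (M : MDP S A) (r : ℕ) (s : S) :
    M.valueToGo r s ∈ Set.Icc (0 : ℝ) r := by
  simpa [MDP.valueToGo] using mem_Icc_of_increments M.valueToGo_increments 0 r s

end Recursion

end Bellman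

/-! ### The visits of a learning run as a sampling process -/

lemma sum_Ico_sum_Icc_eq_sum_range {β : Type*} [AddCommMonoid β] (F : ℕ → ℕ → β) {H : ℕ}
    (hH : 1 ≤ H) (k : ℕ) : ∑ j ∈ Finset.Ico 1 k, ∑ t ∈ Finset.Icc 1 H, F j t
      = ∑ i ∈ Finset.range ((k - 1) * H), F (i / H + 1) (i % H + 1) := by
  rw [Finset.sum_Ico_eq_sum_range]
  induction k - 1 with
  | zero => simp
  | succ m ih =>
    rw [Finset.sum_range_succ, ih, Nat.succ_mul, Finset.sum_range_add]
    congr 1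
    rw [← Finset.Ico_add_one_right_eq_Icc, Finset.sum_Ico_eq_sum_range, Nat.add_sub_cancel]
    refine Finset.sum_congr rfl fun i hi => ?_
    have hi' := Finset.mem_range.1 hi
    rw [mul_comm m H, Nat.mul_add_div (by omega), Nat.mul_add_mod, Nat.div_eq_of_lt hi',
      Nat.mod_eq_of_lt hi', add_comm 1 m, add_comm 1 i, add_zero]

section Runs

variable {S A : Type*} [Fintype S] {M : MDP S A} {K : ℕ}
  {Ω : Type*} [mΩ : MeasurableSpace Ω] {μ : Measure Ω}

/-- The visits to `(s, a)`, with the timesteps of all episodes numbered consecutively from `0`: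
time `i` is timestep `i % H + 1` of episode `i / H + 1`. -/
def LearningRun.visitSet (R : LearningRun M K μ) (s : S) (a : A) (i : ℕ) : Set Ω :=
  {ω | R.state (i / M.H + 1) (i % M.H + 1) ω = s ∧ R.action (i / M.H + 1) (i % M.H + 1) ω = a}

/-- The state that follows time `i`. -/
def LearningRun.nextState (R : LearningRun M K μ) (i : ℕ) : Ω → S :=
  R.state (i / M.H + 1) (i % M.H + 1 + 1)

/-- The information available once the action at time `i` has been chosen. -/
def LearningRun.flatFiltration (R : LearningRun M K μ) : Filtration ℕ mΩ where
  seq i := R.ℱ (i + M.H + 1)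
  mono' _ _ hij := R.ℱ.mono (by omega)
  le' _ := R.ℱ.le _

lemma LearningRun.sampledFrom (R : LearningRun M K μ) (s : S) (a : A) :
    SampledFrom μ R.flatFiltration (K * M.H) (R.visitSet s a) R.nextState (M.p s a) := by
  have hH := M.H_pos
  have hk : ∀ i < K * M.H, i / M.H + 1 ∈ Finset.Icc 1 K := fun i hi =>
    Finset.mem_Icc.2 ⟨Nat.le_add_left 1 _, Nat.div_lt_of_lt_mul (by rwa [mul_comm])⟩
  have ht : ∀ i, i % M.H + 1 ∈ Finset.Icc 1 M.H := fun i =>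
    Finset.mem_Icc.2 ⟨by omega, Nat.mod_lt i hH⟩
  have hidx : ∀ i, (i / M.H + 1) * M.H + (i % M.H + 1) = i + M.H + 1 := fun i => by
    have := Nat.div_add_mod' i M.H
    rw [add_mul]; omega
  refine ⟨fun i hi => ?_, fun i hi s' => ?_, fun i hi s' => ?_⟩
  · have h1 := R.measurable_state _ (hk i hi) _ (ht i) s
    have h2 := R.measurable_action _ (hk i hi) _ (ht i) a
    rw [hidx] at h1 h2
    exact h1.inter h2
  · have h1 := R.measurable_next _ (hk i hi) _ (ht i) s'
    rw [hidx] at h1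
    have e : i + M.H + 1 + 1 = i + 1 + M.H + 1 := by omega
    rw [e] at h1
    exact h1
  · have h1 := R.transition _ (hk i hi) _ (ht i) s'
    rw [hidx] at h1
    filter_upwards [h1] with ω hω hU
    rw [← hU.1, ← hU.2]
    exact hω

variable [DecidableEq S] [DecidableEq A]

lemma LearningRun.visits_eq_visitCount (R : LearningRun M K μ) (k : ℕ) (s : S) (a : A) (ω : Ω) :
    R.visits k s a ω = visitCount (R.visitSet s a) ((k - 1) * M.H) ω := by
  rw [LearningRun.visits, sum_Ico_sum_Icc_eq_sum_range _ M.H_pos, visitCount]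
  refine Finset.sum_congr rfl fun i _ => ?_
  simp [Set.indicator_apply, LearningRun.visitSet]

lemma LearningRun.sum_transitions_mul (R : LearningRun M K μ) (k : ℕ) (s : S) (a : A)
    (f : S → ℝ) (ω : Ω) : ∑ s', (R.transitions k s a s' ω : ℝ) * f s'
      = ∑ i ∈ Finset.range ((k - 1) * M.H),
        (R.visitSet s a i).indicator (fun ω => f (R.nextState i ω)) ω := by
  simp_rw [LearningRun.transitions, sum_Ico_sum_Icc_eq_sum_range _ M.H_pos, Nat.cast_sum,
    Finset.sum_mul]
  rw [Finset.sum_comm]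
  refine Finset.sum_congr rfl fun i _ => ?_
  by_cases hω : ω ∈ R.visitSet s a i
  · rw [Set.indicator_of_mem hω]
    have h1 := hω.1
    have h2 := hω.2
    simp [h1, h2, LearningRun.nextState]
  · rw [Set.indicator_of_notMem hω]
    refine Finset.sum_eq_zero fun s' _ => ?_
    rw [if_neg fun h => hω ⟨h.1, h.2.1⟩]
    simp

lemma LearningRun.expect_pHat_sub (R : LearningRun M K μ) {k : ℕ} {s : S} {a : A} {ω : Ω}
    (hn : 1 ≤ R.visits k s a ω) (f : S → ℝ) :
    expect (R.pHat k s a ω) f - expect (M.p s a) f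
      = centredSum (R.visitSet s a) R.nextState (M.p s a) f ((k - 1) * M.H) ω
        / R.visits k s a ω := by
  have hn0 : (R.visits k s a ω : ℝ) ≠ 0 := by exact_mod_cast (by omega : R.visits k s a ω ≠ 0)
  have h1 : centredSum (R.visitSet s a) R.nextState (M.p s a) f ((k - 1) * M.H) ω
      = ∑ s', (R.transitions k s a s' ω : ℝ) * f s'
        - R.visits k s a ω * expect (M.p s a) f := by
    rw [R.sum_transitions_mul, R.visits_eq_visitCount, centredSum, visitCount, Nat.cast_sum,
      Finset.sum_mul, ← Finset.sum_sub_distrib]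
    refine Finset.sum_congr rfl fun i _ => ?_
    by_cases hω : ω ∈ R.visitSet s a i <;> simp [hω]
  have h2 : expect (R.pHat k s a ω) f
      = (∑ s', (R.transitions k s a s' ω : ℝ) * f s') / R.visits k s a ω := by
    rw [expect, Finset.sum_div]
    exact Finset.sum_congr rfl fun s' _ => by rw [LearningRun.pHat]; ring
  rw [h1, h2]
  field_simp

lemma LearningRun.pHat_mem_stdSimplex (R : LearningRun M K μ) {k : ℕ} {s : S} {a : A} {ω : Ω}
    (hn : 1 ≤ R.visits k s a ω) : R.pHat k s a ω ∈ stdSimplex ℝ S := by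
  refine ⟨fun s' => div_nonneg (Nat.cast_nonneg _) (Nat.cast_nonneg _), ?_⟩
  have h := R.expect_pHat_sub hn fun _ => 1
  rw [centredSum_const (M.p_mem s a), zero_div, expect_const (M.p_mem s a), sub_eq_zero] at h
  simpa [expect] using h

lemma LearningRun.expect_pHat_sub_p (R : LearningRun M K μ) (k : ℕ) (s : S) (a : A) (ω : Ω)
    (f : S → ℝ) : expect (fun s' => R.pHat k s a ω s' - M.p s a s') f
      = expect (R.pHat k s a ω) f - expect (M.p s a) f := by
  simp [expect, sub_mul, Finset.sum_sub_distrib]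

end Runs

/-! ### Confidence levels and the conversion of deviations -/

section Levels

variable {S A Ω : Type*} [Fintype S] [Fintype A] [MeasurableSpace Ω] {μ : Measure Ω}

lemma one_sub_le_measureReal_of_union [IsProbabilityMeasure μ] {G : Set Ω} {E : S → A → Set Ω}
    {ε δ : ℝ} (hδ : Fintype.card S * Fintype.card A * ε = δ) (hE : ∀ s a, μ.real (E s a) ≤ ε)
    (hG : ∀ ω, (∀ s a, ω ∉ E s a) → ω ∈ G) : 1 - δ ≤ μ.real G := by
  subst hδ
  have hcover : Set.univ ⊆ G ∪ ⋃ sa ∈ (Finset.univ : Finset (S × A)), E sa.1 sa.2 := by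
    intro ω _
    by_cases h : ∀ s a, ω ∉ E s a
    · exact Or.inl (hG ω h)
    · push Not at h
      obtain ⟨s, a, h⟩ := h
      exact Or.inr (Set.mem_iUnion₂.2 ⟨(s, a), Finset.mem_univ _, h⟩)
  have h1 : (1 : ℝ) ≤ _ := probReal_univ (μ := μ) ▸ measureReal_mono hcover (measure_ne_top μ _)
  have h2 := measureReal_union_le (μ := μ) G (⋃ sa ∈ (Finset.univ : Finset (S × A)), E sa.1 sa.2)
  have h3 : μ.real (⋃ sa ∈ (Finset.univ : Finset (S × A)), E sa.1 sa.2)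
      ≤ Fintype.card S * Fintype.card A * ε :=
    (measureReal_biUnion_finset_le _ _).trans
      ((Finset.sum_le_card_nsmul _ _ ε fun sa _ => hE _ _).trans (by simp [Fintype.card_prod]))
  linarith

variable {M : MDP S A} {K : ℕ} {δ' : ℝ}

lemma card_mul_exp_neg_logTerm [Nonempty S] [Nonempty A] (hK : 1 ≤ K) (hδ : 0 < δ') :
    (Fintype.card S : ℝ) * Fintype.card A * (2 * ((K * M.H : ℕ) * Real.exp (-logTerm M K δ')))
      = δ' := by
  have hS : (0 : ℝ) < Fintype.card S := by exact_mod_cast Fintype.card_pos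
  have hA : (0 : ℝ) < Fintype.card A := by exact_mod_cast Fintype.card_pos
  have hK' : (0 : ℝ) < K := by exact_mod_cast hK
  have hH : (0 : ℝ) < M.H := by exact_mod_cast M.H_pos
  rw [logTerm, Real.exp_neg, Real.exp_log (by positivity)]
  push_cast
  field_simp

lemma log_two_mul_le_logTerm [Nonempty S] [Nonempty A] (hK : 1 ≤ K) (hδ : 0 < δ') (hδ₁ : δ' < 1) :
    Real.log (2 * (K * M.H : ℕ)) ≤ logTerm M K δ' := by
  have hS : (1 : ℝ) ≤ Fintype.card S := by exact_mod_cast Fintype.card_pos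
  have hA : (1 : ℝ) ≤ Fintype.card A := by exact_mod_cast Fintype.card_pos
  have hK' : (0 : ℝ) < K := by exact_mod_cast hK
  have hH : (0 : ℝ) < M.H := by exact_mod_cast M.H_pos
  refine Real.log_le_log (mul_pos two_pos (Nat.cast_pos.2 (Nat.mul_pos hK M.H_pos))) ?_
  have h0 : (0 : ℝ) ≤ K * M.H := by positivity
  push_cast
  rw [le_div_iff₀ hδ]
  calc 2 * ((K : ℝ) * M.H) * δ' ≤ 2 * (K * M.H) * 1 := by gcongr
    _ = 2 * 1 * 1 * (K * M.H) := by ring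
    _ ≤ _ := by gcongr

end Levels

lemma abs_div_le_sqrt_add {C n v x B : ℝ} (hn : 0 < n) (h₁ : C ≤ √(2 * n * v * x) + B)
    (h₂ : -C ≤ √(2 * n * v * x) + B) : |C / n| ≤ √(2 * v * x / n) + B / n := by
  have h : √(2 * v * x / n) = √(2 * n * v * x) / n := by
    rw [show 2 * v * x / n = 2 * n * v * x / n ^ 2 by field_simp, Real.sqrt_div' _ (by positivity),
      Real.sqrt_sq hn.le]
  rw [h, ← add_div, abs_div, abs_of_pos hn]
  exact div_le_div_of_nonneg_right (abs_le'.2 ⟨h₁, h₂⟩) hn.le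

lemma pred_mul_le {k K H : ℕ} (hk : k ∈ Finset.Icc 1 K) : (k - 1) * H ≤ K * H :=
  Nat.mul_le_mul_right H ((Nat.sub_le k 1).trans (Finset.mem_Icc.1 hk).2)

/-- Outside a Bernstein event, the empirical mean satisfies the confidence bound. -/
lemma LearningRun.abs_expect_pHat_sub_le {S A Ω : Type*} [Fintype S]
    [DecidableEq S] [DecidableEq A] {M : MDP S A} {K : ℕ} [MeasurableSpace Ω] {μ : Measure Ω}
    (R : LearningRun M K μ) {k : ℕ} {s : S} {a : A} {ω : Ω}
    (hn : 1 ≤ R.visits k s a ω) {f : S → ℝ} {v x B : ℝ}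
    (h : |centredSum (R.visitSet s a) R.nextState (M.p s a) f ((k - 1) * M.H) ω|
      ≤ √(2 * visitCount (R.visitSet s a) ((k - 1) * M.H) ω * v * x) + B) :
    |expect (R.pHat k s a ω) f - expect (M.p s a) f|
      ≤ √(2 * v * x / R.visits k s a ω) + B / R.visits k s a ω := by
  rw [R.expect_pHat_sub hn]
  rw [← R.visits_eq_visitCount] at h
  exact abs_div_le_sqrt_add (by exact_mod_cast hn) (le_of_abs_le h) ((neg_le_abs _).trans h)

/-- The empirical standard deviation `τ` is close to `σ` if the empirical mean and the empirical
second moment `m₂` about the true mean satisfy Bernstein bounds; `e` stands for `√(ℓ / n)` and `b`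
for the range. The constant `14 / 5` is slightly less than `2 √2`. -/
lemma abs_sub_le_of_moment_bounds {σ τ b e d m₂ : ℝ} (hσ : 0 ≤ σ) (hσb : σ ≤ b / 2) (hτ : 0 ≤ τ)
    (he : 0 ≤ e) (hd : |d| ≤ 2 * σ * e + 2 / 3 * b * e ^ 2)
    (hm : |m₂ - σ ^ 2| ≤ 2 * b * σ * e + 2 / 3 * b ^ 2 * e ^ 2) (hτm : τ ^ 2 = m₂ - d ^ 2) :
    |τ - σ| ≤ 14 / 5 * b * e := by
  have hb : 0 ≤ b := by linarith
  have hbe : 0 ≤ b * e := by positivity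
  obtain ⟨hm1, hm2⟩ := abs_le.1 hm
  rw [abs_le]
  constructor
  · -- If `σ` is below the claimed error, there is nothing to prove; otherwise `e` is small.
    by_contra! hlt
    have hσe : 14 / 5 * (b * e) < σ := by linarith
    have hb0 : 0 < b := by linarith
    have he1 : e ≤ 5 / 28 := by
      by_contra! h
      nlinarith [mul_lt_mul_of_pos_left h hb0]
    have hd1 : |d| ≤ 28 / 25 * (b * e) := by
      have e1 : 2 * σ * e ≤ b * e := by nlinarith
      have e2 : 2 / 3 * b * e ^ 2 ≤ 5 / 42 * (b * e) := by nlinarith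
      linarith
    have hd2 : d ^ 2 ≤ (28 / 25 * (b * e)) ^ 2 :=
      sq_le_sq' (by linarith [abs_le.1 hd1]) (abs_le.1 hd1).2
    have hτ2 : τ ^ 2 < (σ - 14 / 5 * (b * e)) ^ 2 := by
      refine pow_lt_pow_left₀ (by linarith) hτ two_ne_zero
    nlinarith [mul_nonneg hbe (sub_nonneg.2 hσe.le)]
  · have : τ ≤ σ + b * e := by
      refine le_of_sq_le_sq ?_ (by positivity)
      nlinarith [sq_nonneg d, sq_nonneg (b * e)]
    linarith

/-! ### The three confidence events -/

section Events

variable {S A Ω : Type*} [Fintype S] [Fintype A] [Nonempty A]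
  {M : MDP S A} {K : ℕ} [MeasurableSpace Ω] {μ : Measure Ω} [IsProbabilityMeasure μ]

lemma LearningRun.measure_mean_le (R : LearningRun M K μ) (s : S) (a : A) {x : ℝ} (hx : 0 < x)
    {r : ℕ} (hr : r ≤ M.H) :
    μ.real {ω | ∃ m ≤ K * M.H, 1 ≤ visitCount (R.visitSet s a) m ω ∧
      √(2 * visitCount (R.visitSet s a) m ω * variance (M.p s a) (M.valueToGo r) * x)
          + M.H * x / 3
        < |centredSum (R.visitSet s a) R.nextState (M.p s a) (M.valueToGo r) m ω|}
      ≤ 2 * ((K * M.H : ℕ) * Real.exp (-x)) := by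
  have hp := M.p_mem s a
  have hV := M.valueToGo_mem_Icc r
  have hrH : (r : ℝ) ≤ M.H := by exact_mod_cast hr
  have h0 := le_expect hp fun s' => (hV s').1
  have h1 := expect_le hp fun s' => (hV s').2
  have hneg : expect (M.p s a) (fun s' => -M.valueToGo r s')
      = -expect (M.p s a) (M.valueToGo r) := by
    simp [expect]
  have b1 := (R.sampledFrom s a).measure_all_counts_le hp (f := M.valueToGo r) (b := M.H)
    (fun s' => by linarith [(hV s').2]) le_rfl (Nat.cast_nonneg _) hx
  have b2 := (R.sampledFrom s a).measure_all_counts_le hp (f := fun s' => -M.valueToGo r s')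
    (b := M.H) (fun s' => by rw [hneg]; linarith [(hV s').1])
    (variance_neg _ _).le (Nat.cast_nonneg _) hx
  rw [two_mul]
  refine le_trans (measureReal_mono ?_ (measure_ne_top _ _))
    ((measureReal_union_le _ _).trans (add_le_add b1 b2))
  rintro ω ⟨m, hm, hn, hlt⟩
  rcases lt_abs.1 hlt with h | h
  · exact Or.inl ⟨m, hm, hn, h⟩
  · exact Or.inr ⟨m, hm, hn, by rwa [centredSum_neg]⟩

lemma LearningRun.measure_square_le (R : LearningRun M K μ) (s : S) (a : A) {x : ℝ} (hx : 0 < x)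
    {r : ℕ} (hr : r ≤ M.H) :
    μ.real {ω | ∃ m ≤ K * M.H, 1 ≤ visitCount (R.visitSet s a) m ω ∧
      √(2 * visitCount (R.visitSet s a) m ω
          * (M.H ^ 2 * variance (M.p s a) (M.valueToGo r)) * x) + M.H ^ 2 * x / 3
        < |centredSum (R.visitSet s a) R.nextState (M.p s a)
            (fun s' => (M.valueToGo r s' - expect (M.p s a) (M.valueToGo r)) ^ 2) m ω|}
      ≤ 2 * ((K * M.H : ℕ) * Real.exp (-x)) := by
  have hp := M.p_mem s a
  have hV := M.valueToGo_mem_Icc r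
  have hrH : (r : ℝ) ≤ M.H := by exact_mod_cast hr
  have h0 := le_expect hp fun s' => (hV s').1
  have h1 := expect_le hp fun s' => (hV s').2
  set f : S → ℝ := fun s' => (M.valueToGo r s' - expect (M.p s a) (M.valueToGo r)) ^ 2 with hf
  have habs : ∀ s', |M.valueToGo r s' - expect (M.p s a) (M.valueToGo r)| ≤ M.H := fun s' =>
    abs_le.2 ⟨by linarith [(hV s').1], by linarith [(hV s').2]⟩
  have hf0 : ∀ s', 0 ≤ f s' := fun s' => sq_nonneg _
  have hfH : ∀ s', f s' ≤ (M.H : ℝ) ^ 2 := fun s' =>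
    sq_le_sq' (abs_le.1 (habs s')).1 (abs_le.1 (habs s')).2
  have hvar := variance_sq_sub_expect_le hp habs
  have hneg : expect (M.p s a) (fun s' => -f s') = -expect (M.p s a) f := by simp [expect]
  have g0 := le_expect hp hf0
  have g1 := expect_le hp hfH
  have b1 := (R.sampledFrom s a).measure_all_counts_le hp (f := f)
    (b := (M.H : ℝ) ^ 2) (fun s' => by linarith [hfH s']) hvar (by positivity) hx
  have b2 := (R.sampledFrom s a).measure_all_counts_le hp (f := fun s' => -f s')
    (b := (M.H : ℝ) ^ 2) (fun s' => by rw [hneg]; linarith [hf0 s'])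
    ((variance_neg _ _).trans_le hvar) (by positivity) hx
  rw [two_mul]
  refine le_trans (measureReal_mono ?_ (measure_ne_top _ _))
    ((measureReal_union_le _ _).trans (add_le_add b1 b2))
  rintro ω ⟨m, hm, hn, hlt⟩
  rcases lt_abs.1 hlt with h | h
  · exact Or.inl ⟨m, hm, hn, h⟩
  · exact Or.inr ⟨m, hm, hn, by rwa [centredSum_neg]⟩

variable [DecidableEq S] [DecidableEq A]

/-- For a fixed timestep, Bernstein's inequality and a union bound over the visit counts. -/
lemma LearningRun.fixed_timestep_bound [Nonempty S] (R : LearningRun M K μ) {δ' : ℝ} (hK : 1 ≤ K)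
    (hδ₀ : 0 < δ') (hℓ : 0 < logTerm M K δ') (t : ℕ) :
    1 - δ' ≤ μ.real {ω | ∀ k ∈ Finset.Icc 1 K, ∀ s a, 1 ≤ R.visits k s a ω →
      |expect (fun s' => R.pHat k s a ω s' - M.p s a s') (M.optValue (t + 1))|
        ≤ bernsteinInterval (logTerm M K δ') (M.H * logTerm M K δ' / 3) (R.visits k s a ω)
            (M.p s a) (M.optValue (t + 1))} := by
  have hV : M.optValue (t + 1) = M.valueToGo (M.H - t) := by
    rw [M.optValue_eq_valueToGo, Nat.add_sub_add_right]
  refine one_sub_le_measureReal_of_union (card_mul_exp_neg_logTerm hK hδ₀)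
    (fun s a => R.measure_mean_le s a hℓ (Nat.sub_le M.H t)) fun ω hω k hk s a hn => ?_
  rw [R.expect_pHat_sub_p, hV]
  refine R.abs_expect_pHat_sub_le hn (not_lt.1 fun hlt => hω s a ⟨_, pred_mul_le hk, ?_, hlt⟩)
  rwa [← R.visits_eq_visitCount]

/-- All timesteps at once: the optimal values of consecutive timesteps differ by a function with
values in `[0, 1]`, so the bound for slowly varying families applies. -/
lemma LearningRun.joint_bound [Nonempty S] (R : LearningRun M K μ) {δ' : ℝ} (hK : 1 ≤ K)
    (hδ₀ : 0 < δ') (hδ₁ : δ' < 1) (hℓ : 0 < logTerm M K δ') :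
    1 - δ' ≤ μ.real {ω | ∀ t ∈ Finset.Icc 1 M.H, ∀ k ∈ Finset.Icc 1 K, ∀ s a,
      1 ≤ R.visits k s a ω →
        |expect (fun s' => R.pHat k s a ω s' - M.p s a s') (M.optValue (t + 1))|
          ≤ bernsteinInterval (logTerm M K δ') (3 * M.H * logTerm M K δ') (R.visits k s a ω)
              (M.p s a) (M.optValue (t + 1))} := by
  set ℓ := logTerm M K δ' with hℓdef
  have hH := M.H_pos
  by_cases hsmall : K = 1 ∨ M.H = 1
  · -- There are no visits before the first episode, and for `H = 1` all values involved vanish.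
    have huniv : {ω | ∀ t ∈ Finset.Icc 1 M.H, ∀ k ∈ Finset.Icc 1 K, ∀ s a,
        1 ≤ R.visits k s a ω →
        |expect (fun s' => R.pHat k s a ω s' - M.p s a s') (M.optValue (t + 1))|
          ≤ bernsteinInterval ℓ (3 * M.H * ℓ) (R.visits k s a ω)
              (M.p s a) (M.optValue (t + 1))} = Set.univ := by
      refine Set.eq_univ_of_forall fun ω t ht k hk s a hn => ?_
      rw [Finset.mem_Icc] at ht hk
      rcases hsmall with h1 | h1
      · obtain rfl : k = 1 := by omega
        simp [LearningRun.visits] at hn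
      · have h0 : M.H + 1 - (t + 1) = 0 := by omega
        have : M.optValue (t + 1) = fun _ => 0 := by
          rw [M.optValue_eq_valueToGo, h0]; rfl
        rw [this]
        simp only [expect, mul_zero, Finset.sum_const_zero, abs_zero, bernsteinInterval]
        positivity
    rw [huniv, probReal_univ]; linarith
  have hN4 : 4 ≤ K * M.H := Nat.mul_le_mul (by omega : 2 ≤ K) (by omega : 2 ≤ M.H)
  have hlog : Real.log (2 * (K * M.H : ℕ)) ≤ ℓ := log_two_mul_le_logTerm hK hδ₀ hδ₁
  have hHN : M.H ≤ K * M.H := Nat.le_mul_of_pos_left _ hK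
  set F : ℕ → S → ℝ := M.valueToGo with hF
  set F' : ℕ → S → ℝ := fun r s => r - M.valueToGo r s with hF'
  have hF'inc : ∀ r s, F' r s ≤ F' (r + 1) s ∧ F' (r + 1) s ≤ F' r s + 1 := fun r s => by
    have := M.valueToGo_increments r s
    simp only [hF']; push_cast
    constructor <;> linarith
  refine one_sub_le_measureReal_of_union (card_mul_exp_neg_logTerm hK hδ₀)
    (fun s a => ((measureReal_union_le _ _).trans (add_le_add
      ((R.sampledFrom s a).measure_family_le (M.p_mem s a) (F := F) (fun _ => rfl)
        M.valueToGo_increments hH hHN hN4 hlog)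
      ((R.sampledFrom s a).measure_family_le (M.p_mem s a) (F := F')
        (fun _ => by simp [hF', MDP.valueToGo]) hF'inc hH hHN hN4 hlog))).trans_eq
          (two_mul _).symm) fun ω hω t ht k hk s a hn => ?_
  have hV : M.optValue (t + 1) = F (M.H - t) := by
    rw [M.optValue_eq_valueToGo, Nat.add_sub_add_right]
  have hlt : M.H - t < M.H := by
    have := Finset.mem_Icc.1 ht; omega
  rw [R.expect_pHat_sub_p, hV]
  refine R.abs_expect_pHat_sub_le hn (abs_le'.2 ⟨not_lt.1 fun h1 =>
    hω s a (Or.inl ⟨_, pred_mul_le hk, _, hlt, h1⟩), not_lt.1 fun h1 =>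
    hω s a (Or.inr ⟨_, pred_mul_le hk, _, hlt, ?_⟩)⟩)
  simp only [hF']
  rwa [variance_const_sub (M.p_mem s a), centredSum_sub, centredSum_const (M.p_mem s a), zero_sub]

/-- The empirical standard deviations, by Bernstein's inequality at level `2 ℓ` for the value and
for its squared deviation from the mean. The lower order terms have enough room for doubling `ℓ`,
which pays for the union over the timesteps. -/
lemma LearningRun.finiteTimeBonusBound [Nonempty S] (R : LearningRun M K μ) {δ' : ℝ} (hK : 1 ≤ K)
    (hδ₀ : 0 < δ') (hδ₁ : δ' < 1) (hℓ : 0 < logTerm M K δ') :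
    FiniteTimeBonusBound R δ' (fun p V => √(2 * logTerm M K δ') * √(variance p V))
      (4 * M.H * logTerm M K δ') := by
  set ℓ := logTerm M K δ' with hℓdef
  have hH : (0 : ℝ) < M.H := by exact_mod_cast M.H_pos
  have hN : (0 : ℝ) < (K * M.H : ℕ) := by exact_mod_cast Nat.mul_pos hK M.H_pos
  have hlog : Real.log (2 * (K * M.H : ℕ)) ≤ ℓ := log_two_mul_le_logTerm hK hδ₀ hδ₁
  have hexp : 2 * M.H * Real.exp (-ℓ) ≤ 1 := by
    have h1 : 2 * ((K * M.H : ℕ) : ℝ) ≤ Real.exp ℓ :=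
      (Real.log_le_iff_le_exp (by positivity)).1 hlog
    have h2 : (M.H : ℝ) ≤ (K * M.H : ℕ) := by exact_mod_cast Nat.le_mul_of_pos_left _ hK
    rw [Real.exp_neg, mul_inv_le_iff₀ (Real.exp_pos _)]
    linarith
  have h2ℓ : 0 < 2 * ℓ := by linarith
  have hE : ∀ (s : S) (a : A), μ.real (⋃ t ∈ Finset.Icc 1 M.H,
      ({ω | ∃ m ≤ K * M.H, 1 ≤ visitCount (R.visitSet s a) m ω ∧
        √(2 * visitCount (R.visitSet s a) m ω * variance (M.p s a) (M.valueToGo (M.H - t))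
          * (2 * ℓ)) + M.H * (2 * ℓ) / 3
        < |centredSum (R.visitSet s a) R.nextState (M.p s a) (M.valueToGo (M.H - t)) m ω|} ∪
      {ω | ∃ m ≤ K * M.H, 1 ≤ visitCount (R.visitSet s a) m ω ∧
        √(2 * visitCount (R.visitSet s a) m ω
          * (M.H ^ 2 * variance (M.p s a) (M.valueToGo (M.H - t))) * (2 * ℓ))
            + M.H ^ 2 * (2 * ℓ) / 3
        < |centredSum (R.visitSet s a) R.nextState (M.p s a)
            (fun s' => (M.valueToGo (M.H - t) s'
              - expect (M.p s a) (M.valueToGo (M.H - t))) ^ 2) m ω|}))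
      ≤ 2 * ((K * M.H : ℕ) * Real.exp (-ℓ)) := fun s a => by
    refine (measureReal_biUnion_finset_le _ _).trans ((Finset.sum_le_card_nsmul _ _
      (2 * ((K * M.H : ℕ) * Real.exp (-(2 * ℓ))) + 2 * ((K * M.H : ℕ) * Real.exp (-(2 * ℓ))))
      fun t _ => (measureReal_union_le _ _).trans (add_le_add
        (R.measure_mean_le s a h2ℓ (Nat.sub_le _ _))
        (R.measure_square_le s a h2ℓ (Nat.sub_le _ _)))).trans ?_)
    have he : Real.exp (-(2 * ℓ)) = Real.exp (-ℓ) * Real.exp (-ℓ) := by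
      rw [← Real.exp_add]; ring_nf
    rw [Nat.card_Icc, Nat.add_sub_cancel, nsmul_eq_mul, he]
    calc _ = 2 * ((K * M.H : ℕ) * Real.exp (-ℓ)) * (2 * M.H * Real.exp (-ℓ)) := by ring
      _ ≤ 2 * ((K * M.H : ℕ) * Real.exp (-ℓ)) * 1 := by gcongr
      _ = _ := mul_one _
  rw [FiniteTimeBonusBound]
  refine one_sub_le_measureReal_of_union (card_mul_exp_neg_logTerm hK hδ₀) hE
    fun ω hω t ht k hk s a hn => ?_
  have hV : M.optValue (t + 1) = M.valueToGo (M.H - t) := by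
    rw [M.optValue_eq_valueToGo, Nat.add_sub_add_right]
  rw [hV]
  have hp := M.p_mem s a
  have hq := R.pHat_mem_stdSimplex hn
  have hω' := hω s a
  simp only [Set.mem_iUnion, not_exists] at hω'
  have hvc : 1 ≤ visitCount (R.visitSet s a) ((k - 1) * M.H) ω := by
    rwa [← R.visits_eq_visitCount]
  have h1 := R.abs_expect_pHat_sub_le hn (not_lt.1 fun hlt =>
    hω' t ht (Or.inl ⟨_, pred_mul_le hk, hvc, hlt⟩))
  have h2 := R.abs_expect_pHat_sub_le hn (not_lt.1 fun hlt =>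
    hω' t ht (Or.inr ⟨_, pred_mul_le hk, hvc, hlt⟩))
  set V := M.valueToGo (M.H - t)
  set p := M.p s a
  set n : ℝ := (R.visits k s a ω : ℝ) with hn'
  have hn0 : 0 < n := Nat.cast_pos.2 hn
  have hσ2 : √(variance p V) ^ 2 = variance p V := Real.sq_sqrt (variance_nonneg hp V)
  have he2 : √(ℓ / n) ^ 2 = ℓ / n := Real.sq_sqrt (by positivity)
  have key : |√(variance (R.pHat k s a ω) V) - √(variance p V)|
      ≤ 14 / 5 * M.H * √(ℓ / n) := by
    refine abs_sub_le_of_moment_bounds (Real.sqrt_nonneg _) ?_ (Real.sqrt_nonneg _)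
      (Real.sqrt_nonneg _) (d := expect (R.pHat k s a ω) V - expect p V)
      (m₂ := expect (R.pHat k s a ω) fun s' => (V s' - expect p V) ^ 2)
      (h1.trans (le_of_eq ?_)) ?_ ?_
    · rw [Real.sqrt_le_left (by positivity)]
      have hle : ((M.H - t : ℕ) : ℝ) ≤ M.H := by exact_mod_cast Nat.sub_le _ _
      have := variance_le_of_mem_Icc hp (f := V) (a := 0) (b := M.H) fun s' =>
        ⟨(M.valueToGo_mem_Icc _ s').1, (M.valueToGo_mem_Icc _ s').2.trans hle⟩
      rwa [sub_zero] at this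
    · rw [show 2 * variance p V * (2 * ℓ) / n = 2 ^ 2 * (variance p V * (ℓ / n)) by ring,
        Real.sqrt_mul (by positivity), Real.sqrt_sq (by norm_num),
        Real.sqrt_mul (variance_nonneg hp V), he2]
      ring
    · have e : expect p (fun s' => (V s' - expect p V) ^ 2) = √(variance p V) ^ 2 := hσ2.symm
      rw [← e]
      refine h2.trans (le_of_eq ?_)
      rw [show 2 * ((M.H : ℝ) ^ 2 * variance p V) * (2 * ℓ) / n
          = (2 * M.H) ^ 2 * (variance p V * (ℓ / n)) by ring,
        Real.sqrt_mul (by positivity), Real.sqrt_sq (by positivity),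
        Real.sqrt_mul (variance_nonneg hp V), he2]
      ring
    · rw [Real.sq_sqrt (variance_nonneg hq V), expect, sum_mul_sub_sq hq]
      ring
  rw [← mul_sub, abs_mul, abs_of_nonneg (Real.sqrt_nonneg _)]
  have hs2 : √2 ≤ 10 / 7 := by rw [Real.sqrt_le_left (by norm_num)]; norm_num
  calc √(2 * ℓ) * |√(variance (R.pHat k s a ω) V) - √(variance p V)|
      ≤ √(2 * ℓ) * (14 / 5 * M.H * √(ℓ / n)) := by gcongr
    _ = √2 * (14 / 5 * M.H * (√ℓ * √ℓ) / √n) := by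
        rw [Real.sqrt_mul (by norm_num), Real.sqrt_div hℓ.le]; ring
    _ ≤ 10 / 7 * (14 / 5 * M.H * (√ℓ * √ℓ) / √n) := by gcongr
    _ = 4 * M.H * ℓ / √n := by rw [Real.mul_self_sqrt hℓ.le]; ring

end Events

end Euler

theorem mainTheorem6 {S A Ω : Type*} [Fintype S] [DecidableEq S] [Nonempty S]
    [Fintype A] [DecidableEq A] [Nonempty A] (M : Euler.MDP S A) (K : ℕ) (hK : 1 ≤ K)
    (δ' : ℝ) (hδ₀ : 0 < δ') (hδ₁ : δ' < 1)
    [MeasurableSpace Ω] (μ : MeasureTheory.Measure Ω) [MeasureTheory.IsProbabilityMeasure μ]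
    (R : Euler.LearningRun M K μ) (ℓ L J : ℝ)
    (hℓ : ℓ = Euler.logTerm M K δ') (hL : L = √(2 * ℓ)) (hJ : J = 3 * (M.H : ℝ) * ℓ) :
    Euler.IsAdmissible R δ' (Euler.bernsteinInterval ℓ J)
        (fun p V => L * √(Euler.variance p V)) (fun _ _ => J) J L (4 * (M.H : ℝ) * ℓ) ∧
      ∀ t ∈ Finset.Icc 1 M.H,
        1 - δ' ≤ μ.real {ω | ∀ k ∈ Finset.Icc 1 K, ∀ s a, 1 ≤ R.visits k s a ω →
          |Euler.expect (fun s' => R.pHat k s a ω s' - M.p s a s') (M.optValue (t + 1))|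
            ≤ Euler.bernsteinInterval ℓ ((M.H : ℝ) * ℓ / 3) (R.visits k s a ω)
                (M.p s a) (M.optValue (t + 1))} := by
  subst hℓ hL hJ
  have hℓ0 : 0 < Euler.logTerm M K δ' := by
    refine lt_of_lt_of_le (Real.log_pos ?_) (Euler.log_two_mul_le_logTerm hK hδ₀ hδ₁)
    have : (1 : ℝ) ≤ (K * M.H : ℕ) := by exact_mod_cast Nat.mul_pos hK M.H_pos
    linarith
  refine ⟨⟨⟨R.joint_bound hK hδ₀ hδ₁ hℓ0, fun n _ p hp V => ?_, fun _ _ _ => le_rfl,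
    fun p hp V₁ V₂ => ?_, fun p hp α => ?_⟩, R.finiteTimeBonusBound hK hδ₀ hδ₁ hℓ0⟩,
    fun t _ => R.fixed_timestep_bound hK hδ₀ hℓ0 t⟩
  · rw [Euler.bernsteinInterval, ← Real.sqrt_mul (by positivity), Real.sqrt_div
      (by have := Euler.variance_nonneg hp V; positivity),
      show 2 * Euler.variance p V * Euler.logTerm M K δ'
        = 2 * Euler.logTerm M K δ' * Euler.variance p V by ring]
  · rw [← mul_sub, abs_mul, abs_of_nonneg (Real.sqrt_nonneg _)]
    exact mul_le_mul_of_nonneg_left ((Euler.abs_sqrt_variance_sub_le hp V₁ V₂).trans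
      (Euler.sqrt_variance_le_norm2 hp _)) (Real.sqrt_nonneg _)
  · simp [Euler.variance, Euler.expect_const hp]
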